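/- Theorem 2.3. Let $p$ be a prime, let $A$ and $B$ be groups with subgroups $H \leqslant A$ and $K \leqslant B$, let $\varphi : H \to K$ be an isomorphism, and let $G = (A * B;\, H = K, \varphi)$ be the free product of $A$ and $B$ with $H$ and $K$ amalgamated according to $\varphi$; regard $A$ and $B$ as subgroups of $G$. A subgroup $F$ of a group $X$ is called $p$-separable if for every $g \in X \setminus F$ there is a homomorphism $\psi$ of $X$ onto a finite $p$-group such that $g\psi \notin F\psi$; $X$ is called residually $p$-finite if its trivial subgroup is $p$-separable. A subgroup $F$ of $X$ is called $p'$-isolated if, for every $g \in X$ and every prime $q \neq p$, $g^q \in F$ implies $g \in F$. Let $\Delta_A^p$ (respectively $\Delta_B^p$) be the family of all $p'$-isolated cyclic subgroups of $A$ (respectively of $B$) that are not $p$-separable in $A$ (respectively in $B$). Suppose that $H$ and $K$ are infinite cyclic, and that neither the centralizer of $H$ in $A$ nor the centralizer of $K$ in $B$ contains a nontrivial element of finite order. If $G$ is residually $p$-finite, then $G$ satisfies the following condition: $(**)$ every $p'$-isolated cyclic subgroup of $G$ that is not conjugate in $G$ to any subgroup of the family $\Delta_A^p \cup \Delta_B^p$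 is $p$-separable in $G$. -/

import Mathlib

universe u

namespace AmalgSep

section Separability

variable {X : Type u} [Group X]

/-- A subgroup `F` of a group `X` is `p`-separable (separable by the finite `p`-groups) if for
every element `g` outside `F` there is a homomorphism `ψ` of `X` onto a finite `p`-group with
`ψ g` outside `ψ F`. (The target is a quotient of `X`, so its universe is that of `X`.) -/
def IsPSeparable (p : ℕ) (F : Subgroup X) : Prop :=
  ∀ g : X, g ∉ F → ∃ (P : Type u) (_ : Group P) (ψ : X →* P),
    Finite P ∧ IsPGroup p P ∧ Function.Surjective ψ ∧ ψ g ∉ F.map ψ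

/-- `X` is residually `p`-finite: its trivial subgroup is `p`-separable. -/
def ResiduallyPFinite (p : ℕ) (X : Type u) [Group X] : Prop :=
  IsPSeparable p (⊥ : Subgroup X)

/-- `F` is `p'`-isolated: for every prime `q ≠ p`, `g ^ q ∈ F` implies `g ∈ F`. -/
def IsPPrimeIsolated (p : ℕ) (F : Subgroup X) : Prop :=
  ∀ (g : X) (q : ℕ), q.Prime → q ≠ p → g ^ q ∈ F → g ∈ F

/-- `E` is conjugate to `F` in `X`, that is, `E = x F x⁻¹` for some `x`. -/
def IsConjSubgroup (E F : Subgroup X) : Prop :=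
  ∃ x : X, E = F.map (MulAut.conj x).toMonoidHom

/-- The family of all `p'`-isolated cyclic subgroups of `X` which are not `p`-separable. -/
def Delta (p : ℕ) (X : Type u) [Group X] : Set (Subgroup X) :=
  {F | IsCyclic F ∧ IsPPrimeIsolated p F ∧ ¬ IsPSeparable p F}

end Separability

section Amalgam

/-- The two free factors, as a family indexed by `Bool`. -/
def Factor (A B : Type u) : Bool → Type u
  | false => A
  | true => B

instance Factor.group (A B : Type u) [Group A] [Group B] : ∀ i, Group (Factor A B i)
  | false => inferInstanceAs (Group A)
  | true => inferInstanceAs (Group B)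

variable {A B : Type u} [Group A] [Group B] {H : Subgroup A} {K : Subgroup B}

/-- The embeddings of the amalgamated subgroup `H` into the factors: the inclusion into `A`, and
`φ` followed by the inclusion of `K` into `B`. -/
def embed (φ : H ≃* K) : ∀ i, H →* Factor A B i
  | false => H.subtype
  | true => K.subtype.comp φ.toMonoidHom

/-- The free product `(A * B; H = K, φ)` of `A` and `B` with the subgroups `H` and `K`
amalgamated according to the isomorphism `φ`. -/
abbrev Amalgam (φ : H ≃* K) : Type u :=
  Monoid.PushoutI (embed φ)

/-- The canonical homomorphism of `A` into the amalgamated free product. -/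
def inA (φ : H ≃* K) : A →* Amalgam φ :=
  Monoid.PushoutI.of (φ := embed φ) false

/-- The canonical homomorphism of `B` into the amalgamated free product. -/
def inB (φ : H ≃* K) : B →* Amalgam φ :=
  Monoid.PushoutI.of (φ := embed φ) true

/-- Condition `(**)`: every `p'`-isolated cyclic subgroup of the amalgamated free product which
is not conjugate to a subgroup of the families `Delta p A` and `Delta p B` (viewed inside the
amalgamated free product) is `p`-separable. -/
def ConditionStarStar (p : ℕ) (φ : H ≃* K) : Prop :=
  ∀ F : Subgroup (Amalgam φ), IsCyclic F → IsPPrimeIsolated p F →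
    (∀ D ∈ Delta p A, ¬ IsConjSubgroup F (D.map (inA φ))) →
    (∀ D ∈ Delta p B, ¬ IsConjSubgroup F (D.map (inB φ))) →
    IsPSeparable p F

end Amalgam

end AmalgSep

/-! A subgroup is `p`-separable exactly when it is closed in the pro-`p` topology, so the task is to
show that `F = ⟨f⟩` equals its closure. An element `g` of the closure commutes with `f`: it does so
in every finite `p`-quotient, and `G` is residually `p`-finite. Hence `g` lies in the centralizer of
`f`, which normal forms in the amalgam describe. Write `C = ⟨c⟩` for the amalgamated subgroup.

Two topological facts carry the proof. First, the pro-`p` topology of `G` induces the full pro-`p`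
topology on each factor (`exists_extension`, `mem_of_mem_pClosure_of_isPSeparable`). This rests on
Higman's theorem that finite `p`-groups can be amalgamated along a cyclic subgroup inside a finite
`p`-group (`exists_overgroup`). Second, `C` is closed in `G` as soon as its closure meets each
factor in `C` (`IsAmalgam.pClosure_le`). This uses a unipotent representation on a module of paths.

If `f` has finite order, residual `p`-finiteness suffices. Otherwise there are three cases up to
conjugacy. If `f` lies in a factor and is not conjugate into `C` there, its centralizer lies in that
factor and separability there applies (`pClosure_le_of_mem_factor`). If `f` lies in `C`, isolation
and separability of `F` in both factors make `C` closed, so the closure of `F` stays in a factor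
(`pClosure_le_of_mem_base`). If `f` is cyclically reduced of positive even length, some `y = g ^ n *
f ^ m` with `n > 0` lies in `C`. When `y = 1`, isolation gives `g ∈ F`. When `y ≠ 1`, its commuting
with `f` forces `C` to be closed, while a power of `f` lies in the closure of `⟨y⟩`, hence in `C`,
which is absurd (`pClosure_le_of_cyclically_reduced`). -/

namespace AmalgSep

/-! ### Normal forms and centralizers in an amalgam. -/

section Words

variable {G : Type u} [Group G]

/-- `AltWord S E C i n g` says that `g` is a product of `n` letters taken alternately from
`S i`, `S (i + 1)`, ..., none of them in `E`, followed by an element of `C`. -/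
inductive AltWord (S : ZMod 2 → Subgroup G) (E C : Subgroup G) : ZMod 2 → ℕ → G → Prop
  | base (i : ZMod 2) {h : G} (hh : h ∈ C) : AltWord S E C i 0 h
  | cons {i : ZMod 2} {n : ℕ} {a g : G} (ha : a ∈ S i) (haE : a ∉ E)
      (hg : AltWord S E C (i + 1) n g) : AltWord S E C i (n + 1) (a * g)

/-- `G` is the internal free product of `S 0` and `S 1` with the amalgamated subgroup `C`. -/
structure IsAmalgam (S : ZMod 2 → Subgroup G) (C : Subgroup G) : Prop where
  le : ∀ i, C ≤ S i
  notMem : ∀ {i n g}, AltWord S C C i (n + 1) g → g ∉ C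
  exists_word : ∀ g, ∃ i n, AltWord S C C i n g
  exists_lift : ∀ {U : Type u} [Group U] (α : ∀ i, S i →* U),
    (∀ (c : G) (h0 : c ∈ S 0) (h1 : c ∈ S 1), c ∈ C → α 0 ⟨c, h0⟩ = α 1 ⟨c, h1⟩) →
    ∃ Ψ : G →* U, ∀ i (s : S i), Ψ s = α i s

theorem zmod_two_add_one_add_one (i : ZMod 2) : i + 1 + 1 = i := by
  revert i; decide

theorem zmod_two_eq_or (i j : ZMod 2) : j = i ∨ j = i + 1 := by
  revert i j; decide

namespace AltWord

variable {S : ZMod 2 → Subgroup G} {E C : Subgroup G} {i j : ZMod 2} {m n : ℕ} {g g' h a : G}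

theorem cast (hg : AltWord S E C i n g) (hij : i = j) (hmn : n = m) : AltWord S E C j m g := by
  subst hij hmn; exact hg

theorem mem_of_zero (hg : AltWord S E C i 0 g) : g ∈ C := by
  cases hg; assumption

theorem of_letter (ha : a ∈ S i) (haE : a ∉ E) : AltWord S E C i 1 a := by
  simpa using cons (n := 0) ha haE (base (i + 1) C.one_mem)

theorem exists_cons (hg : AltWord S E C i (n + 1) g) :
    ∃ a u, a ∈ S i ∧ a ∉ E ∧ AltWord S E C (i + 1) n u ∧ g = a * u := by
  cases hg with
  | cons ha haE hu => exact ⟨_, _, ha, haE, hu, rfl⟩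

theorem mul_mem_left (hC : ∀ i, C ≤ S i) (hg : AltWord S C C i n g) (hh : h ∈ C) :
    AltWord S C C i n (h * g) := by
  cases hg with
  | base i hx => exact base i (C.mul_mem hh hx)
  | cons ha haE hu =>
    rw [← mul_assoc]
    exact cons ((S i).mul_mem (hC i hh) ha) (fun hc => haE ((C.mul_mem_cancel_left hh).1 hc)) hu

theorem append (hC : ∀ i, C ≤ S i) (hg : AltWord S C C i n g) :
    ∀ {j m g'}, AltWord S C C j m g' → j = i + n → AltWord S C C i (n + m) (g * g') := by
  induction hg with
  | base i hx =>
    intro j m g' hg' hj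
    exact (hg'.mul_mem_left hC hx).cast (by simpa using hj) (by simp)
  | @cons i n a g ha haE _ ih =>
    intro j m g' hg' hj
    rw [mul_assoc]
    exact (cons ha haE (ih hg' (by rw [hj]; push_cast; ring))).cast rfl (by ring)

theorem inv (hC : ∀ i, C ≤ S i) (hg : AltWord S C C i n g) :
    AltWord S C C (i + n + 1) n g⁻¹ := by
  induction hg with
  | base i hx => exact base _ (C.inv_mem hx)
  | @cons i n a g ha haE _ ih =>
    rw [mul_inv_rev]
    have h1 : AltWord S C C i 1 a⁻¹ :=
      of_letter ((S i).inv_mem ha) (fun hc => haE (by simpa using C.inv_mem hc))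
    refine (ih.append hC h1 ?_).cast ?_ rfl
    · have h2 := zmod_two_add_one_add_one i
      have h3 := zmod_two_add_one_add_one (n : ZMod 2)
      have h4 : (n : ZMod 2) + n = 0 := CharTwo.add_self_eq_zero _
      linear_combination -h2 - h4
    · push_cast; ring

theorem exists_split {r : ℕ} (hg : AltWord S E C i (r + m) g) :
    ∃ u v, AltWord S E C i r u ∧ AltWord S E C (i + r) m v ∧ g = u * v := by
  induction r generalizing i g with
  | zero => exact ⟨1, g, base i C.one_mem, hg.cast (by simp) (by simp), by simp⟩
  | succ r ih =>
    obtain ⟨a, u, ha, haE, hu, rfl⟩ := (hg.cast rfl (by ring : r + 1 + m = (r + m) + 1)).exists_cons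
    obtain ⟨u', v, hu', hv, rfl⟩ := ih hu
    exact ⟨a * u', v, cons ha haE hu', hv.cast (by push_cast; ring) rfl, by group⟩

theorem mono {E' : Subgroup G} (hE : E' ≤ E) (hg : AltWord S E C i n g) :
    AltWord S E' C i n g := by
  induction hg with
  | base i hx => exact base i hx
  | cons ha haE _ ih => exact cons ha (fun hc => haE (hE hc)) ih

theorem pow (hC : ∀ i, C ≤ S i) (hg : AltWord S C C i n g) (hn : (n : ZMod 2) = 0) (k : ℕ) :
    AltWord S C C i (k * n) (g ^ k) := by
  induction k with
  | zero => simpa using base i C.one_mem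
  | succ k ih =>
    rw [pow_succ]
    exact (ih.append hC hg (by push_cast; rw [hn]; ring)).cast rfl (by ring)

end AltWord

namespace IsAmalgam

variable {S : ZMod 2 → Subgroup G} {C : Subgroup G} (hS : IsAmalgam S C)
  {i j : ZMod 2} {m n r : ℕ} {f g g' a x y : G}
include hS

theorem notMem_of_pos (hg : AltWord S C C i n g) (hn : 0 < n) : g ∉ C := by
  obtain ⟨k, rfl⟩ := Nat.exists_eq_succ_of_ne_zero hn.ne'
  exact hS.notMem hg

/-- Conjugating a letter outside `C` by a word starting in the other factor gives a word. -/
theorem conj_word (hu : AltWord S C C (i + 1) n g) (hx : x ∈ S i) (hxC : x ∉ C) :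
    AltWord S C C (i + n) (2 * n + 1) (g⁻¹ * x * g) := by
  have h1 := hu.inv hS.le
  have h2 : AltWord S C C i (1 + n) (x * g) := (AltWord.of_letter hx hxC).append hS.le hu (by simp)
  rw [mul_assoc]
  refine (h1.append hS.le h2 ?_).cast ?_ (by ring)
  · have h2 := zmod_two_add_one_add_one i
    have h4 : (n : ZMod 2) + n = 0 := CharTwo.add_self_eq_zero _
    linear_combination - h2 - h4
  · have h2 := zmod_two_add_one_add_one i
    linear_combination h2

/-- Two words for elements of the same left coset of `C` have the same length, and the same type
unless they are empty. -/
theorem length_eq (hg : AltWord S C C i n g) (hg' : AltWord S C C j m g') (h : g⁻¹ * g' ∈ C) :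
    n = m ∧ (0 < n → i = j) := by
  induction n generalizing i j m g g' with
  | zero =>
    refine ⟨?_, by simp⟩
    by_contra hm
    refine hS.notMem_of_pos hg' (Nat.pos_of_ne_zero (Ne.symm hm)) ?_
    have := C.mul_mem hg.mem_of_zero h
    simpa using this
  | succ n ih =>
    rcases m with _ | m
    · exfalso
      refine hS.notMem hg ?_
      have := C.mul_mem hg'.mem_of_zero (C.inv_mem h)
      simpa using this
    · rcases zmod_two_eq_or i j with rfl | rfl
      · obtain ⟨a, u, ha, haC, hu, rfl⟩ := hg.exists_cons
        obtain ⟨a', u', ha', haC', hu', rfl⟩ := hg'.exists_cons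
        have hx : a⁻¹ * a' ∈ S j := (S j).mul_mem ((S j).inv_mem ha) ha'
        by_cases hxC : a⁻¹ * a' ∈ C
        · have := ih hu (hu'.mul_mem_left hS.le hxC) (by convert h using 1; group)
          exact ⟨by rw [this.1], fun _ => rfl⟩
        · exfalso
          have h1 := (hu.inv hS.le)
          have h2 := AltWord.cons hx hxC hu'
          refine hS.notMem_of_pos (h1.append hS.le h2 ?_) (by omega) (by convert h using 1; group)
          have h2 := zmod_two_add_one_add_one j
          have h4 : (n : ZMod 2) + n = 0 := CharTwo.add_self_eq_zero _
          linear_combination - h2 - h4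
      · exfalso
        have h1 := hg.inv hS.le
        refine hS.notMem_of_pos (h1.append hS.le hg' ?_) (by omega) h
        have h4 : ((n + 1 : ℕ) : ZMod 2) + (n + 1 : ℕ) = 0 := CharTwo.add_self_eq_zero _
        linear_combination -h4

/-- Prefixes of equal length of two words for the same element are in the same coset. -/
theorem prefix_coset {u u' v v' : G} {m' : ℕ} (hu : AltWord S C C i r u)
    (hu' : AltWord S C C i r u') (hv : AltWord S C C (i + r) m v)
    (hv' : AltWord S C C (i + r) m' v') (h : u * v = u' * v') : u⁻¹ * u' ∈ C := by
  induction r generalizing i u u' with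
  | zero => exact C.mul_mem (C.inv_mem hu.mem_of_zero) hu'.mem_of_zero
  | succ r ih =>
    obtain ⟨a, w, ha, haC, hw, rfl⟩ := hu.exists_cons
    obtain ⟨b, w', hb, hbC, hw', rfl⟩ := hu'.exists_cons
    have hx : a⁻¹ * b ∈ S i := (S i).mul_mem ((S i).inv_mem ha) hb
    have e : i + ((r + 1 : ℕ) : ZMod 2) = i + 1 + r := by push_cast; ring
    have key : w * v = (a⁻¹ * b * w') * v' := by
      have := congrArg (a⁻¹ * ·) h
      simpa [mul_assoc] using this
    by_cases hxC : a⁻¹ * b ∈ C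
    · have := ih hw (hw'.mul_mem_left hS.le hxC) (hv.cast e rfl) (hv'.cast e rfl) key
      convert this using 1; group
    · exfalso
      have h1 := hw.append hS.le (hv.cast e rfl) rfl
      have h2 := AltWord.cons hx hxC (hw'.append hS.le (hv'.cast e rfl) rfl)
      have := hS.length_eq h1 h2 (by rw [key]; simp [mul_assoc])
      have h3 := hS.length_eq h2 h1 (by rw [key]; simp [mul_assoc])
      have h4 := h3.2 (by omega)
      revert h4
      generalize i = k
      revert k; decide

theorem mem_factor_of_one (hg : AltWord S C C i 1 g) : g ∈ S i := by
  obtain ⟨a, u, ha, -, hu, rfl⟩ := hg.exists_cons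
  exact (S i).mul_mem ha (hS.le i hu.mem_of_zero)

/-- Cyclic reduction. -/
theorem exists_conj_cyclically_reduced (f : G) :
    (∃ i x s, s ∈ S i ∧ f = x * s * x⁻¹) ∨
      ∃ x i L f', f = x * f' * x⁻¹ ∧ AltWord S C C i L f' ∧ (L : ZMod 2) = 0 ∧ 0 < L := by
  obtain ⟨i, n, hf⟩ := hS.exists_word f
  induction n using Nat.strong_induction_on generalizing i f with
  | _ n ih =>
    rcases Nat.eq_zero_or_pos n with rfl | hn
    · exact .inl ⟨i, 1, f, hS.le i hf.mem_of_zero, by simp⟩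
    by_cases hn2 : (n : ZMod 2) = 0
    · exact .inr ⟨1, i, n, f, by simp, hf, hn2, hn⟩
    by_cases hn1 : n = 1
    · subst hn1
      exact .inl ⟨i, 1, f, hS.mem_factor_of_one hf, by simp⟩
    obtain ⟨k, rfl⟩ : ∃ k, n = k + 1 + 1 := ⟨n - 2, by omega⟩
    have hk : (k : ZMod 2) + 1 = 0 := by
      have : ∀ z : ZMod 2, z ≠ 0 → z = 1 := by decide
      have := this _ hn2
      push_cast at this
      linear_combination this
    obtain ⟨a, u, ha, haC, hu, rfl⟩ := hf.exists_cons
    obtain ⟨v, b, hv, hb, rfl⟩ := hu.exists_split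
    have hb' : b ∈ S i := hS.mem_factor_of_one (hb.cast (by linear_combination hk) rfl)
    -- At odd length at least 3 the first and last letters lie in the same factor; conjugating by
    -- the last one merges them and shortens the word.
    have e : a * (v * b) = b⁻¹ * ((b * a) * v) * b⁻¹⁻¹ := by group
    have transfer : ((∃ i x s, s ∈ S i ∧ (b * a) * v = x * s * x⁻¹) ∨
      ∃ x i L f', (b * a) * v = x * f' * x⁻¹ ∧ AltWord S C C i L f' ∧ (L : ZMod 2) = 0 ∧ 0 < L) →
      ((∃ i x s, s ∈ S i ∧ a * (v * b) = x * s * x⁻¹) ∨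
      ∃ x i L f', a * (v * b) = x * f' * x⁻¹ ∧ AltWord S C C i L f' ∧
        (L : ZMod 2) = 0 ∧ 0 < L) := by
      rintro (⟨i, x, s, hs, h⟩ | ⟨x, i, L, f', h, h'⟩)
      · exact .inl ⟨i, b⁻¹ * x, s, hs, by rw [e, h]; group⟩
      · exact .inr ⟨b⁻¹ * x, i, L, f', by rw [e, h]; group, h'⟩
    apply transfer
    by_cases hba : b * a ∈ C
    · exact ih k (by omega) _ (i + 1) (hv.mul_mem_left hS.le hba)
    · exact ih (k + 1) (by omega) _ i (.cons ((S i).mul_mem hb' ha) hba hv)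

/-- If a nontrivial element of `C` commutes with a cyclically reduced element, then each factor has
an element outside `C` conjugating some nontrivial element of `C` into `C`. -/
theorem exists_conj_mem_of_commute (hf : AltWord S C C i n f) (hn : 2 ≤ n) (hy : y ∈ C)
    (hy1 : y ≠ 1) (hc : Commute y f) (j : ZMod 2) :
    ∃ b ∈ S j, b ∉ C ∧ ∃ z ∈ C, z ≠ 1 ∧ b⁻¹ * z * b ∈ C := by
  obtain ⟨k, rfl⟩ : ∃ k, n = k + 1 + 1 := ⟨n - 2, by omega⟩
  obtain ⟨a, u, ha, haC, hu, rfl⟩ := hf.exists_cons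
  obtain ⟨b, v, hb, hbC, hv, rfl⟩ := hu.exists_cons
  have hyf : (a * (b * v))⁻¹ * y * (a * (b * v)) = y := by
    rw [mul_assoc, hc.eq]; group
  -- Otherwise no cancellation would occur in `f⁻¹ * y * f`, a nonempty reduced word equal to `y ∈
  -- C`. The same argument then applies to the second letter.
  have h1 : a⁻¹ * y * a ∈ C := by
    by_contra h
    have := hS.conj_word hu ((S i).mul_mem ((S i).mul_mem ((S i).inv_mem ha) (hS.le i hy)) ha) h
    refine hS.notMem this ?_
    convert hy using 1
    conv_rhs => rw [← hyf]
    group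
  have h1' : a⁻¹ * y * a ≠ 1 := fun h => hy1 (by
    have := congrArg (fun t => a * t * a⁻¹) h
    simpa [mul_assoc] using this)
  have h2 : b⁻¹ * (a⁻¹ * y * a) * b ∈ C := by
    by_contra h
    have := hS.conj_word hv ((S (i + 1)).mul_mem ((S (i + 1)).mul_mem ((S (i + 1)).inv_mem hb)
      (hS.le _ h1)) hb) h
    refine hS.notMem this ?_
    convert hy using 1
    conv_rhs => rw [← hyf]
    group
  rcases zmod_two_eq_or i j with rfl | rfl
  · exact ⟨a, ha, haC, y, hy, hy1, h1⟩
  · exact ⟨b, hb, hbC, _, h1, h1', h2⟩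

/-- The centralizer of an element of a factor not conjugate into `C` there lies in the factor. -/
theorem mem_factor_of_commute (hf : f ∈ S i) (hfC : ∀ a ∈ S i, a⁻¹ * f * a ∉ C)
    (hc : Commute f g) : g ∈ S i := by
  have hf0 : f ∉ C := by simpa using hfC 1 (S i).one_mem
  have hfg : g⁻¹ * f * g = f := by rw [mul_assoc, hc.eq]; group
  have hf1 : AltWord S C C i 1 f := .of_letter hf hf0
  obtain ⟨j, n, hg⟩ := hS.exists_word g
  rcases Nat.eq_zero_or_pos n with rfl | hn
  · exact hS.le i hg.mem_of_zero
  rcases zmod_two_eq_or i j with rfl | rfl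
  · obtain ⟨k, rfl⟩ : ∃ k, n = k + 1 := ⟨n - 1, by omega⟩
    obtain ⟨a, u, ha, haC, hu, rfl⟩ := hg.exists_cons
    have h1 := hS.conj_word hu ((S j).mul_mem ((S j).mul_mem ((S j).inv_mem ha) hf) ha)
      (hfC a ha)
    have h2 : u⁻¹ * (a⁻¹ * f * a) * u = f := by
      conv_rhs => rw [← hfg]
      group
    rw [h2] at h1
    have := (hS.length_eq h1 hf1 (by simp)).1
    obtain rfl : k = 0 := by omega
    exact (S j).mul_mem ha (hS.le j hu.mem_of_zero)
  · have h1 := hS.conj_word hg hf hf0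
    rw [hfg] at h1
    have := (hS.length_eq h1 hf1 (by simp)).1
    omega

/-- An element commuting with a cyclically reduced `f` and having a word that starts like `f` is
in one of finitely many cosets of `C`, up to powers of `f`. -/
theorem exists_prefix_of_commute {L : ℕ} (hf : AltWord S C C i L f) (hL : (L : ZMod 2) = 0)
    (hL0 : 0 < L) {q q' : ℕ → G} (hq : ∀ k < L, AltWord S C C i k (q k))
    (hq' : ∀ k < L, AltWord S C C (i + k) (L - k) (q' k)) (hqq : ∀ k < L, f = q k * q' k)
    (hy : AltWord S C C i r y) (hc : Commute y f) :
    ∃ s : ℕ, ∃ k < L, (q k)⁻¹ * (f ^ s)⁻¹ * y ∈ C := by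
  -- If `r` were odd, `f * y * f⁻¹ = y` would be reduced of length `r + 2 * L`.
  have hr : (r : ZMod 2) = 0 := by
    by_contra hr
    have hr1 : (r : ZMod 2) = 1 := by
      have : ∀ z : ZMod 2, z ≠ 0 → z = 1 := by decide
      exact this _ hr
    have h1 := hf.append hS.le hy (by rw [hL, add_zero])
    have h2 := h1.append hS.le (hf.inv hS.le) (by push_cast; rw [hL, hr1]; ring)
    have h3 : f * y * f⁻¹ = y := by rw [← hc.eq]; group
    rw [h3] at h2
    have := (hS.length_eq h2 hy (by simp)).1
    omega
  have hk : r % L < L := Nat.mod_lt _ hL0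
  refine ⟨r / L, r % L, hk, ?_⟩
  have hrL : r / L * L + r % L = r := Nat.div_add_mod' r L
  have hp : AltWord S C C i r (f ^ (r / L) * q (r % L)) :=
    ((hf.pow hS.le hL (r / L)).append hS.le (hq _ hk) (by push_cast; rw [hL]; ring)).cast rfl hrL
  have hkr : ((r % L : ℕ) : ZMod 2) = r := by
    conv_rhs => rw [← hrL]
    push_cast; rw [hL]; ring
  have hF := hf.pow hS.le hL (r / L + 1)
  have ht : AltWord S C C (i + r) _ (q' (r % L) * y) :=
    ((hq' _ hk).cast (by rw [hkr]) rfl).append hS.le hy (by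
      rw [hr, Nat.cast_sub hk.le, hkr, hr, hL]; ring)
  -- Both `y` and `f ^ (r / L) * q (r % L)` are prefixes of length `r` of the single element `y * f
  -- ^ (r / L + 1) = f ^ (r / L + 1) * y`.
  have := hS.prefix_coset hp hy ht (hF.cast (by rw [hr, add_zero]) rfl) (by
    have e : f ^ (r / L) * q (r % L) * (q' (r % L) * y) = f ^ (r / L + 1) * y := by
      calc _ = f ^ (r / L) * (q (r % L) * q' (r % L)) * y := by simp only [mul_assoc]
        _ = _ := by rw [← hqq _ hk, ← pow_succ]
    rw [e, ((hc.pow_right _).eq)])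
  convert this using 1; group

theorem exists_finite_cosets_of_commute {L : ℕ} (hf : AltWord S C C i L f)
    (hL : (L : ZMod 2) = 0) (hL0 : 0 < L) :
    ∃ q : ℕ → G, ∀ y r, AltWord S C C i r y → Commute y f →
      ∃ s : ℤ, ∃ k < L, (q k)⁻¹ * f ^ s * y ∈ C := by
  have : ∀ k, ∃ q q', k < L → AltWord S C C i k q ∧ AltWord S C C (i + k) (L - k) q' ∧
      f = q * q' := by
    intro k
    by_cases hk : k < L
    · obtain ⟨u, v, hu, hv, e⟩ :=
        (hf.cast rfl (by omega : L = k + (L - k))).exists_split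
      exact ⟨u, v, fun _ => ⟨hu, hv, e⟩⟩
    · exact ⟨1, 1, fun h => absurd h hk⟩
  choose q q' hq using this
  refine ⟨q, fun y r hy hc => ?_⟩
  obtain ⟨s, k, hk, h⟩ := hS.exists_prefix_of_commute hf hL hL0 (fun k hk => (hq k hk).1)
    (fun k hk => (hq k hk).2.1) (fun k hk => (hq k hk).2.2) hy hc
  exact ⟨-s, k, hk, by simpa using h⟩

/-- The centralizer of a cyclically reduced element of positive length is commensurable with the
cyclic subgroup it generates, modulo `C`. -/
theorem exists_pow_mul_zpow_mem {L : ℕ} (hf : AltWord S C C i L f) (hL : (L : ZMod 2) = 0)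
    (hL0 : 0 < L) (hc : Commute x f) : ∃ n : ℕ, 0 < n ∧ ∃ m : ℤ, x ^ n * f ^ m ∈ C := by
  obtain ⟨q, hq⟩ := hS.exists_finite_cosets_of_commute hf hL hL0
  -- Powers of `x` whose words start in the other factor are compared with `f⁻¹`, whose word starts
  -- there.
  obtain ⟨q', hq'⟩ := hS.exists_finite_cosets_of_commute
    ((hf.inv hS.le).cast (by rw [hL, add_zero] : i + (L : ZMod 2) + 1 = i + 1) rfl) hL hL0
  have key : ∀ n : ℕ, ∃ (t : Bool × Fin L) (s : ℤ),
      (if t.1 then q t.2 else q' t.2)⁻¹ * f ^ s * x ^ n ∈ C := by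
    intro n
    obtain ⟨j, r, hy⟩ := hS.exists_word (x ^ n)
    rcases zmod_two_eq_or i j with rfl | rfl
    · obtain ⟨s, k, hk, h⟩ := hq _ r hy (hc.pow_left n)
      exact ⟨(true, ⟨k, hk⟩), s, by simpa using h⟩
    · obtain ⟨s, k, hk, h⟩ := hq' _ r hy (hc.pow_left n).inv_right
      exact ⟨(false, ⟨k, hk⟩), -s, by simpa using h⟩
  choose t s hts using key
  -- Pigeonhole: modulo powers of `f`, all powers of `x` fall into at most `2 * L` cosets of `C`.
  obtain ⟨a, b, hab, e⟩ := Finite.exists_ne_map_eq_of_infinite t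
  wlog hlt : a < b generalizing a b
  · exact this b a hab.symm e.symm (by omega)
  refine ⟨b - a, by omega, s b - s a, ?_⟩
  have h := C.mul_mem (C.inv_mem (hts a)) (hts b)
  rw [e] at h
  generalize (if (t b).1 then q (t b).2 else q' (t b).2) = w at h
  have h2 : (w⁻¹ * f ^ s a * x ^ a)⁻¹ * (w⁻¹ * f ^ s b * x ^ b) = x ^ (b - a) * f ^ (s b - s a) := by
    have e1 : x ^ b = x ^ a * x ^ (b - a) := by rw [← pow_add]; congr 1; omega
    have c1 : Commute (f ^ (s b - s a)) (x ^ a) := ((hc.symm.zpow_left _).pow_right _)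
    have c2 : Commute (f ^ (s b - s a)) (x ^ (b - a)) := ((hc.symm.zpow_left _).pow_right _)
    have e2 : (w⁻¹ * f ^ s a * x ^ a)⁻¹ * (w⁻¹ * f ^ s b * x ^ b)
        = (x ^ a)⁻¹ * (f ^ (s b - s a)) * x ^ b := by
      rw [sub_eq_neg_add, zpow_add, zpow_neg]; group
    rw [e2, e1, mul_assoc, ← mul_assoc (f ^ _), c1.eq, ← c2.eq]; group
  rwa [h2] at h

end IsAmalgam

end Words

/-! ### The pro-`p` closure of a cyclic subgroup. -/

section Closure

variable {X : Type u} [Group X]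

/-- The closure of a subgroup in the pro-`p` topology. -/
def pClosure (p : ℕ) (F : Subgroup X) : Subgroup X where
  carrier := {g | ∀ (P : Type u) [Group P] [Finite P], IsPGroup p P →
    ∀ ψ : X →* P, ψ g ∈ F.map ψ}
  mul_mem' ha hb P _ _ hP ψ := by
    rw [map_mul]; exact mul_mem (ha P hP ψ) (hb P hP ψ)
  one_mem' P _ _ hP ψ := by rw [map_one]; exact one_mem _
  inv_mem' ha P _ _ hP ψ := by rw [map_inv]; exact inv_mem (ha P hP ψ)

theorem mem_pClosure {p : ℕ} {F : Subgroup X} {g : X} :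
    g ∈ pClosure p F ↔ ∀ (P : Type u) [Group P] [Finite P], IsPGroup p P →
      ∀ ψ : X →* P, ψ g ∈ F.map ψ := Iff.rfl

theorem isPSeparable_iff {p : ℕ} {F : Subgroup X} : IsPSeparable p F ↔ pClosure p F ≤ F := by
  constructor
  · intro h g hg
    by_contra hgF
    obtain ⟨P, _, ψ, hfin, hP, -, hψ⟩ := h g hgF
    exact hψ (hg P hP ψ)
  · intro h g hg
    have h1 : g ∉ pClosure p F := fun hc => hg (h hc)
    simp only [mem_pClosure, not_forall] at h1
    obtain ⟨P, _, _, hP, ψ, hψ⟩ := h1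
    refine ⟨ψ.range, inferInstance, ψ.rangeRestrict, inferInstance, hP.to_subgroup _,
      ψ.rangeRestrict_surjective, ?_⟩
    rintro ⟨x, hx, hxg⟩
    exact hψ ⟨x, hx, congrArg Subtype.val hxg⟩

theorem le_pClosure (p : ℕ) (F : Subgroup X) : F ≤ pClosure p F :=
  fun _ hg _ _ _ _ _ => Subgroup.mem_map_of_mem _ hg

theorem pClosure_le {p : ℕ} {F F' : Subgroup X} (h : F ≤ pClosure p F') :
    pClosure p F ≤ pClosure p F' := by
  intro g hg P _ _ hP ψ
  obtain ⟨x, hx, e⟩ := hg P hP ψ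
  rw [← e]
  exact h hx P hP ψ

theorem pClosure_zpowers_le {p : ℕ} {f : X} {F : Subgroup X} (h : f ∈ pClosure p F) :
    pClosure p (Subgroup.zpowers f) ≤ pClosure p F :=
  pClosure_le (by simpa [Subgroup.zpowers_le] using h)

theorem exists_zpow_of_mem_pClosure {p : ℕ} {f g : X} (hg : g ∈ pClosure p (Subgroup.zpowers f))
    {P : Type u} [Group P] [Finite P] (hP : IsPGroup p P) (ψ : X →* P) :
    ∃ i : ℤ, ψ g = ψ f ^ i := by
  obtain ⟨x, ⟨i, rfl⟩, e⟩ := hg P hP ψ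
  exact ⟨i, by rw [← e, map_zpow]⟩

theorem mem_pClosure_zpowers {p : ℕ} {f g : X}
    (h : ∀ (P : Type u) [Group P] [Finite P], IsPGroup p P → ∀ ψ : X →* P,
      ψ g ∈ Subgroup.zpowers (ψ f)) : g ∈ pClosure p (Subgroup.zpowers f) := by
  intro P _ _ hP ψ
  rw [MonoidHom.map_zpowers]
  exact h P hP ψ

theorem pow_mem_pClosure {p : ℕ} {f g : X} (hg : g ∈ pClosure p (Subgroup.zpowers f)) (n : ℕ) :
    g ^ n ∈ pClosure p (Subgroup.zpowers (f ^ n)) := by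
  refine mem_pClosure_zpowers fun P _ _ hP ψ => ?_
  obtain ⟨i, hi⟩ := exists_zpow_of_mem_pClosure hg hP ψ
  refine ⟨i, ?_⟩
  simp only [map_pow, hi]
  rw [← zpow_natCast, ← zpow_natCast, ← zpow_mul, ← zpow_mul, mul_comm]

theorem conj_mem_pClosure {p : ℕ} {f g : X} (hg : g ∈ pClosure p (Subgroup.zpowers f)) (x : X) :
    x⁻¹ * g * x ∈ pClosure p (Subgroup.zpowers (x⁻¹ * f * x)) := by
  refine mem_pClosure_zpowers fun P _ _ hP ψ => ?_
  obtain ⟨i, hi⟩ := exists_zpow_of_mem_pClosure hg hP ψ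
  refine ⟨i, ?_⟩
  have := conj_zpow (i := i) (a := (ψ x)⁻¹) (b := ψ f)
  simp only [map_mul, map_inv, hi]
  simpa using this

theorem mem_zpowers_zpow_of_isPGroup {p : ℕ} (hp : p.Prime) {P : Type*} [Group P]
    (hP : IsPGroup p P) (x : P) {m : ℤ} (hm : ¬ (p : ℤ) ∣ m) : x ∈ Subgroup.zpowers (x ^ m) := by
  have := Fact.mk hp
  rw [mem_zpowers_zpow_iff]
  obtain ⟨k, hk⟩ := IsPGroup.iff_orderOf.1 hP x
  rw [hk, Int.gcd_eq_natAbs, Int.natAbs_natCast]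
  refine Nat.Coprime.pow_right _ (Nat.Coprime.symm ?_)
  rw [hp.coprime_iff_not_dvd]
  rwa [Int.natCast_dvd] at hm

theorem self_mem_pClosure_zpow {p : ℕ} (hp : p.Prime) (f : X) {m : ℤ} (hm : ¬ (p : ℤ) ∣ m) :
    f ∈ pClosure p (Subgroup.zpowers (f ^ m)) := by
  refine mem_pClosure_zpowers fun P _ _ hP ψ => ?_
  rw [map_zpow]
  exact mem_zpowers_zpow_of_isPGroup hp hP _ hm

theorem isPGroup_prod {p : ℕ} {P Q : Type*} [Group P] [Group Q] (hP : IsPGroup p P)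
    (hQ : IsPGroup p Q) : IsPGroup p (P × Q) := by
  rw [isPGroup_iff_pow_pow_eq_one] at *
  rintro ⟨x, y⟩
  obtain ⟨a, ha⟩ := hP x
  obtain ⟨b, hb⟩ := hQ y
  refine ⟨a + b, ?_⟩
  ext
  · simp [pow_add, pow_mul, ha]
  · simp [pow_add, pow_mul', hb]

section Residual

variable {p : ℕ} (hp : p.Prime) (hX : ResiduallyPFinite p X) {f g x y z : X}
include hX

theorem exists_hom_ne_one (hx : x ≠ 1) : ∃ (P : Type u) (_ : Group P) (_ : Finite P) (ψ : X →* P),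
    IsPGroup p P ∧ ψ x ≠ 1 := by
  obtain ⟨P, _, ψ, hfin, hP, -, hψ⟩ := hX x (by simpa using hx)
  exact ⟨P, _, hfin, ψ, hP, by simpa using hψ⟩

theorem eq_of_forall_hom (h : ∀ (P : Type u) [Group P] [Finite P], IsPGroup p P →
    ∀ ψ : X →* P, ψ x = ψ y) : x = y := by
  by_contra hxy
  obtain ⟨P, _, _, ψ, hP, hψ⟩ := exists_hom_ne_one hX (x := x * y⁻¹) (by simpa [mul_inv_eq_one])
  exact hψ (by rw [map_mul, map_inv, h P hP ψ, mul_inv_cancel])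

/-- In each finite `p`-quotient `g` becomes a power of `f`, so the commutation relation holds there
and residual `p`-finiteness lifts it. -/
theorem commute_of_mem_pClosure (hg : g ∈ pClosure p (Subgroup.zpowers f)) (hz : Commute z f) :
    Commute z g := by
  refine eq_of_forall_hom hX fun P _ _ hP ψ => ?_
  obtain ⟨i, hi⟩ := exists_zpow_of_mem_pClosure hg hP ψ
  rw [map_mul, map_mul, hi]
  exact ((hz.map ψ).zpow_right i).eq

theorem commute_of_mem_pClosure_of_mem_pClosure (hg : g ∈ pClosure p (Subgroup.zpowers f))
    (hx : x ∈ pClosure p (Subgroup.zpowers f)) : Commute x g :=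
  commute_of_mem_pClosure hX hg (commute_of_mem_pClosure hX hx (Commute.refl f)).symm

theorem eq_one_of_mem_pClosure_one (hg : g ∈ pClosure p (Subgroup.zpowers (1 : X))) : g = 1 := by
  refine eq_of_forall_hom hX fun P _ _ hP ψ => ?_
  obtain ⟨i, hi⟩ := exists_zpow_of_mem_pClosure hg hP ψ
  simp [hi]

/-- Finitely many nontrivial elements survive in a common finite `p`-quotient. -/
theorem exists_hom_forall_ne_one {T : Set X} (hT : T.Finite) (h1 : 1 ∉ T) :
    ∃ (P : Type u) (_ : Group P) (_ : Finite P) (ψ : X →* P),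
      IsPGroup p P ∧ ∀ t ∈ T, ψ t ≠ 1 := by
  induction T, hT using Set.Finite.induction_on with
  | empty => exact ⟨PUnit, inferInstance, inferInstance, 1, IsPGroup.of_subsingleton _ _, by simp⟩
  | @insert a T _ _ ih =>
    obtain ⟨P, _, _, ψ, hP, hψ⟩ := ih (fun h => h1 (Set.mem_insert_of_mem _ h))
    obtain ⟨Q, _, _, θ, hQ, hθ⟩ := exists_hom_ne_one hX (x := a)
      (fun h => h1 (h ▸ Set.mem_insert _ _))
    refine ⟨P × Q, inferInstance, inferInstance, ψ.prod θ, isPGroup_prod hP hQ, ?_⟩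
    intro t ht
    rw [MonoidHom.prod_apply, Ne, Prod.mk_eq_one]
    rcases Set.mem_insert_iff.1 ht with rfl | ht
    · exact fun h => hθ h.2
    · exact fun h => hψ t ht h.1

theorem isPSeparable_of_finite {F : Subgroup X} (hF : (F : Set X).Finite) : IsPSeparable p F := by
  rw [isPSeparable_iff]
  intro g hg
  by_contra hgF
  obtain ⟨P, _, _, ψ, hP, hψ⟩ := exists_hom_forall_ne_one hX (hF.image fun x => g * x⁻¹) (by
    rintro ⟨x, hx, h⟩
    have h : g * x⁻¹ = 1 := h
    rw [mul_inv_eq_one] at h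
    exact hgF (h ▸ hx))
  obtain ⟨x, hx, e⟩ := hg P hP ψ
  exact hψ _ ⟨x, hx, rfl⟩ (by rw [map_mul, map_inv, e, mul_inv_cancel])

include hp

/-- The closure of `⟨f⟩` behaves like a quotient of the `p`-adic integers, whose nontrivial closed
subgroups are open. A quotient `Q` in which `g` survives, with `f` of order `p ^ e`, is paired with
an arbitrary `P`. The exponent expressing `g` through `f` is then not divisible by `p ^ e`, a bound
independent of `P`. -/
theorem exists_pow_mem_pClosure (hg : g ∈ pClosure p (Subgroup.zpowers f)) (hg1 : g ≠ 1) :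
    ∃ v : ℕ, f ^ p ^ v ∈ pClosure p (Subgroup.zpowers g) := by
  have := Fact.mk hp
  obtain ⟨Q, _, _, θ, hQ, hθ⟩ := exists_hom_ne_one hX hg1
  obtain ⟨e, he⟩ := IsPGroup.iff_orderOf.1 hQ (θ f)
  refine ⟨e, mem_pClosure_zpowers fun P _ _ hP ψ => ?_⟩
  obtain ⟨i, hi⟩ := exists_zpow_of_mem_pClosure hg (isPGroup_prod hP hQ) (ψ.prod θ)
  have hi1 : ψ g = ψ f ^ i := congrArg Prod.fst hi
  have hi2 : θ g = θ f ^ i := congrArg Prod.snd hi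
  have hei : ¬ ((p : ℤ) ^ e ∣ i) := by
    intro h
    apply hθ
    rw [hi2, ← orderOf_dvd_iff_zpow_eq_one, he]
    exact_mod_cast h
  have hi0 : i ≠ 0 := by rintro rfl; simp at hei
  obtain ⟨a, m, hm, ham⟩ := Nat.exists_eq_pow_mul_and_not_dvd (n := i.natAbs)
    (by simpa using hi0) p hp.one_lt.ne'
  have hae : a < e := by
    by_contra h
    apply hei
    rw [← Int.dvd_natAbs, ham]
    push_cast
    exact Dvd.dvd.mul_right (pow_dvd_pow _ (by omega)) _
  have h1 : (ψ f) ^ p ^ a ∈ Subgroup.zpowers (ψ g) := by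
    have h2 := mem_zpowers_zpow_of_isPGroup hp hP (ψ f ^ p ^ a) (m := m)
      (by exact_mod_cast hm)
    rw [zpow_natCast, ← pow_mul, ← ham] at h2
    have h3 : ψ f ^ i.natAbs ∈ Subgroup.zpowers (ψ g) := by
      have h : (i.natAbs : ℤ) = i ∨ (i.natAbs : ℤ) = -i := by omega
      rw [hi1, ← zpow_natCast]
      rcases h with h | h <;> rw [h]
      · exact Subgroup.mem_zpowers _
      · rw [zpow_neg]; exact inv_mem (Subgroup.mem_zpowers _)
    exact (Subgroup.zpowers_le.2 h3) h2
  obtain ⟨d, rfl⟩ := Nat.exists_eq_add_of_lt hae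
  rw [map_pow, add_assoc, pow_add p, pow_mul]
  exact Subgroup.pow_mem _ h1 _

/-- If `g ≠ 1`, some `f ^ p ^ v` lies in the closure of `⟨g⟩`, so torsion of `g` would pass to `f`.
-/
theorem eq_one_of_pow_eq_one_of_mem_pClosure (hf : ¬ IsOfFinOrder f)
    (hg : g ∈ pClosure p (Subgroup.zpowers f)) {n : ℕ} (hn : 0 < n) (hgn : g ^ n = 1) : g = 1 := by
  by_contra hg1
  obtain ⟨v, hv⟩ := exists_pow_mem_pClosure hp hX hg hg1
  have h1 := pow_mem_pClosure hv n
  rw [hgn] at h1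
  have h2 := eq_one_of_mem_pClosure_one hX h1
  rw [← pow_mul] at h2
  exact hf (isOfFinOrder_iff_pow_eq_one.2 ⟨_, Nat.mul_pos (pow_pos hp.pos _) hn, h2⟩)

theorem exists_hom_pow_dvd_orderOf (hf : ¬ IsOfFinOrder f) (k : ℕ) :
    ∃ (P : Type u) (_ : Group P) (_ : Finite P) (ψ : X →* P),
      IsPGroup p P ∧ p ^ k ∣ orderOf (ψ f) := by
  have := Fact.mk hp
  obtain ⟨P, _, _, ψ, hP, hψ⟩ := exists_hom_ne_one hX (x := f ^ p ^ k)
    (fun h => hf (isOfFinOrder_iff_pow_eq_one.2 ⟨_, pow_pos hp.pos _, h⟩))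
  refine ⟨P, inferInstance, inferInstance, ψ, hP, ?_⟩
  obtain ⟨e, he⟩ := IsPGroup.iff_orderOf.1 hP (ψ f)
  rw [he]
  refine pow_dvd_pow _ ?_
  by_contra h
  apply hψ
  rw [map_pow, ← orderOf_dvd_iff_pow_eq_one, he]
  exact pow_dvd_pow _ (by omega)

/-- A quotient in which the order of `f` is divisible by `p ^ k` shows that the exponent `j` with `g
^ p ^ k = f ^ j` is a multiple of `p ^ k`. Dividing out, `g` differs from a power of `f` by a
torsion element of the closure, which is trivial. -/
theorem mem_zpowers_of_pow_prime_pow_mem (hf : ¬ IsOfFinOrder f)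
    (hg : g ∈ pClosure p (Subgroup.zpowers f)) {k : ℕ}
    (hgk : g ^ p ^ k ∈ Subgroup.zpowers f) : g ∈ Subgroup.zpowers f := by
  obtain ⟨j, hj⟩ := hgk
  have hj : f ^ j = g ^ p ^ k := hj
  obtain ⟨P, _, _, ψ, hP, hψ⟩ := exists_hom_pow_dvd_orderOf hp hX hf k
  obtain ⟨i, hi⟩ := exists_zpow_of_mem_pClosure hg hP ψ
  have h1 : ψ f ^ (i * (p ^ k : ℕ) - j) = 1 := by
    rw [zpow_sub, zpow_mul, ← hi, zpow_natCast, ← map_pow, ← hj, map_zpow, mul_inv_cancel]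
  rw [← orderOf_dvd_iff_zpow_eq_one] at h1
  have h2 : ((p ^ k : ℕ) : ℤ) ∣ i * (p ^ k : ℕ) - j := (Int.natCast_dvd_natCast.2 hψ).trans h1
  obtain ⟨j', rfl⟩ : ((p ^ k : ℕ) : ℤ) ∣ j := by
    have := (dvd_sub (Dvd.intro_left i rfl) h2)
    simpa using this
  have hc : Commute g f := (commute_of_mem_pClosure hX hg (Commute.refl f)).symm
  have h3 : (g * (f ^ j')⁻¹) ^ p ^ k = 1 := by
    rw [(hc.zpow_right j').inv_right.mul_pow, ← hj, inv_pow, ← zpow_natCast, ← zpow_mul, mul_comm j',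
      mul_inv_cancel]
  have h4 := eq_one_of_pow_eq_one_of_mem_pClosure hp hX hf
    (mul_mem hg (inv_mem (zpow_mem (le_pClosure p _ (Subgroup.mem_zpowers f)) j')))
    (pow_pos hp.pos k) h3
  rw [mul_inv_eq_one] at h4
  exact ⟨j', h4.symm⟩

end Residual

theorem IsPPrimeIsolated.mem_of_pow_mem {p : ℕ} {F : Subgroup X} (hF : IsPPrimeIsolated p F) {n : ℕ}
    (hn : ¬ p ∣ n) {g : X} (hg : g ^ n ∈ F) : g ∈ F := by
  induction n using induction_on_primes generalizing g with
  | zero => simp at hn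
  | one => simpa using hg
  | prime_mul q n hq ih =>
    refine hF g q hq (fun h => hn (by simp [h])) (ih (fun h => hn (Dvd.dvd.mul_left h q)) ?_)
    rwa [← pow_mul]

theorem IsPPrimeIsolated.mem_zpowers_of_pow_mem {p : ℕ} (hp : p.Prime) (hX : ResiduallyPFinite p X)
    {f g : X} (hF : IsPPrimeIsolated p (Subgroup.zpowers f)) (hf : ¬ IsOfFinOrder f)
    (hg : g ∈ pClosure p (Subgroup.zpowers f)) {n : ℕ} (hn : 0 < n)
    (hgn : g ^ n ∈ Subgroup.zpowers f) : g ∈ Subgroup.zpowers f := by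
  obtain ⟨a, m, hm, rfl⟩ := Nat.exists_eq_pow_mul_and_not_dvd hn.ne' p hp.one_lt.ne'
  rw [pow_mul] at hgn
  exact mem_zpowers_of_pow_prime_pow_mem hp hX hf hg (hF.mem_of_pow_mem hm hgn)

end Closure

/-! ### Wreath products: conjugacy and the Kaloujnine-Krasner embedding. -/

section Wreath

variable {D U P : Type*} [CommGroup D] [Group U] [Group P]

theorem wreath_pow_left (a : D ≀ᵣ U) (n : ℕ) (x : U) :
    (a ^ n).left x = ∏ s ∈ Finset.range n, a.left ((a.right ^ s)⁻¹ * x) := by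
  induction n generalizing x with
  | zero => simp
  | succ n ih =>
    rw [pow_succ', RegularWreathProduct.mul_left, Pi.mul_apply, ih, Finset.prod_range_succ',
      mul_comm]
    simp only [pow_succ, mul_inv_rev, ← mul_assoc, pow_zero, inv_one, one_mul]
    simp only [← mul_inv_rev, ← pow_succ, ← pow_succ']

/-- A function on a finite group whose norms along a cyclic group acting by translations are
trivial is a coboundary. -/
theorem exists_coboundary [Finite U] (c : U) (m : U → D)
    (hm : ∀ u, ∏ s ∈ Finset.range (orderOf c), m ((c ^ s)⁻¹ * u) = 1) :
    ∃ v : U → D, ∀ u, v u = m u * v (c⁻¹ * u) := by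
  -- Partial norms along an orbit of `⟨c⟩`. The full norm is trivial, so they depend only on the
  -- length modulo the order of `c`, and measuring length from a chosen orbit representative gives
  -- `v`.
  let Φ : U → ℕ → D := fun u n => ∏ s ∈ Finset.range n, m ((c ^ s)⁻¹ * u)
  have hΦs : ∀ u n, Φ u (n + 1) = m u * Φ (c⁻¹ * u) n := by
    intro u n
    simp only [Φ]
    rw [Finset.prod_range_succ', mul_comm]
    simp [pow_succ', mul_assoc]
  have hΦp : ∀ u, Function.Periodic (Φ u) (orderOf c) := by
    intro u n
    simp only [Φ]
    rw [add_comm, Finset.prod_range_add, hm, one_mul]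
    refine Finset.prod_congr rfl fun s _ => ?_
    rw [pow_add, pow_orderOf_eq_one, one_mul]
  let τ : U → U := fun u => (Quotient.mk (QuotientGroup.rightRel (Subgroup.zpowers c)) u).out
  have hτ : ∀ u, ∃ n : ℕ, c ^ n * τ u = u := by
    intro u
    classical
    have h : (QuotientGroup.rightRel (Subgroup.zpowers c)) (τ u) u := Quotient.mk_out u
    rw [QuotientGroup.rightRel_apply, mem_zpowers_iff_mem_range_orderOf] at h
    obtain ⟨n, -, hn⟩ := Finset.mem_image.1 h
    exact ⟨n, by rw [hn]; group⟩
  have hτc : ∀ u, τ (c⁻¹ * u) = τ u := by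
    intro u
    refine congrArg Quotient.out (Quotient.sound ?_)
    change (QuotientGroup.rightRel _) _ _
    rw [QuotientGroup.rightRel_apply]
    simp
  choose t ht using hτ
  refine ⟨fun u => Φ u (t u), fun u => ?_⟩
  change Φ u (t u) = m u * Φ (c⁻¹ * u) (t (c⁻¹ * u))
  rw [← hΦs, ← (hΦp u).map_mod_nat, ← (hΦp u).map_mod_nat (_ + 1)]
  congr 1
  have h1 := ht (c⁻¹ * u)
  rw [hτc] at h1
  have h2 : c ^ t u * τ u = c ^ (t (c⁻¹ * u) + 1) * τ u := by
    rw [pow_succ', mul_assoc, h1, ht u]; group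
  exact pow_eq_pow_iff_modEq.1 (mul_right_cancel h2)

/-- Elements of a wreath product with the same projection of order `r` and the same `r`-th power
are conjugate by an element of the base group. -/
theorem exists_conj_wreath [Finite U] (a b : D ≀ᵣ U) (hr : a.right = b.right)
    (hp : a ^ orderOf a.right = b ^ orderOf a.right) :
    ∃ w : D ≀ᵣ U, w.right = 1 ∧ w * a * w⁻¹ = b := by
  -- For `w = (v, 1)` the equation `w * a = b * w` says that `b.left / a.left` is the coboundary of
  -- `v`; its norms are trivial because the two powers agree.
  obtain ⟨v, hv⟩ := exists_coboundary a.right (fun u => b.left u / a.left u) (by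
    intro u
    rw [Finset.prod_div_distrib, ← wreath_pow_left]
    conv_lhs => enter [1, 2, s]; rw [hr]
    rw [← wreath_pow_left, hp, div_self'])
  refine ⟨⟨v, 1⟩, rfl, ?_⟩
  rw [mul_inv_eq_iff_eq_mul]
  ext u
  · simp only [RegularWreathProduct.mul_left, Pi.mul_apply, inv_one, one_mul, ← hr]
    rw [hv]
    simp [div_eq_mul_inv, mul_comm, mul_left_comm]
  · simp [hr]

/-- The Kaloujnine-Krasner map for a central kernel. -/
theorem exists_wreath_hom (π : P →* U) {z : P} (hz : z ∈ Subgroup.center P)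
    (hker : π.ker = Subgroup.zpowers z) (e : Subgroup.zpowers z →* D) :
    ∃ Θ : P →* D ≀ᵣ U, (∀ x, (Θ x).right = π x) ∧
      ∀ (k : Subgroup.zpowers z) (u : U), (Θ k).left u = e k := by
  have hcen : ∀ k ∈ π.ker, ∀ x, x * k = k * x := fun k hk =>
    Subgroup.mem_center_iff.1 ((Subgroup.zpowers_le.2 hz) (hker ▸ hk))
  let τ : U → U := fun u => (Quotient.mk (QuotientGroup.rightRel π.range) u).out
  have hτ : ∀ u, ∃ n : P, π n * τ u = u := by
    intro u
    have h : (QuotientGroup.rightRel π.range) (τ u) u := Quotient.mk_out u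
    rw [QuotientGroup.rightRel_apply] at h
    obtain ⟨n, hn⟩ := h
    exact ⟨n, by rw [hn]; group⟩
  have hτx : ∀ x u, τ (π x * u) = τ u := by
    intro x u
    refine congrArg Quotient.out (Quotient.sound ?_)
    change (QuotientGroup.rightRel _) _ _
    rw [QuotientGroup.rightRel_apply]
    exact ⟨x⁻¹, by simp⟩
  choose n hn using hτ
  have hk : ∀ x u, x * n ((π x)⁻¹ * u) * (n u)⁻¹ ∈ π.ker := by
    intro x u
    have h1 := hn ((π x)⁻¹ * u)
    rw [← map_inv, hτx, map_inv] at h1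
    rw [MonoidHom.mem_ker, map_mul, map_mul, map_inv, mul_inv_eq_one]
    refine mul_right_cancel (b := τ u) ?_
    rw [hn u, mul_assoc, h1]; group
  -- The kernel component of `x` relative to the section `n`; centrality of the kernel makes it a
  -- cocycle, and for `x` in the kernel the two values of `n` cancel.
  let δ : P → U → D := fun x u => e ⟨_, hker ▸ hk x u⟩
  have hδ : ∀ x y u, δ (x * y) u = δ x u * δ y ((π x)⁻¹ * u) := by
    intro x y u
    simp only [δ]
    rw [← map_mul]
    congr 1
    ext
    simp only [Subgroup.coe_mul]
    have h1 := hcen _ (hk y ((π x)⁻¹ * u)) (x * n ((π x)⁻¹ * u) * (n u)⁻¹)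
    rw [h1]
    have h2 := hcen _ (hk y ((π x)⁻¹ * u)) x
    simp only [← mul_assoc] at h2 ⊢
    rw [← h2, map_mul, mul_inv_rev]
    group
  refine ⟨MonoidHom.mk' (fun x => ⟨δ x, π x⟩) fun x y => ?_, fun x => rfl, fun k u => ?_⟩
  · ext u
    · exact hδ x y u
    · exact map_mul π x y
  · change e _ = e k
    congr 1
    ext
    have h : π (k : P) = 1 := by
      rw [← MonoidHom.mem_ker, hker]; exact k.2
    simp [h]

theorem wreath_hom_injective (π : P →* U) {z : P} (hker : π.ker = Subgroup.zpowers z)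
    (e : Subgroup.zpowers z →* D) (he : Function.Injective e) (Θ : P →* D ≀ᵣ U)
    (h1 : ∀ x, (Θ x).right = π x) (h2 : ∀ (k : Subgroup.zpowers z) (u : U), (Θ k).left u = e k) :
    Function.Injective Θ := by
  rw [injective_iff_map_eq_one]
  intro x hx
  have hxk : x ∈ Subgroup.zpowers z := by
    rw [← hker, MonoidHom.mem_ker, ← h1, hx]; rfl
  have := h2 ⟨x, hxk⟩ 1
  rw [hx] at this
  have h3 : e ⟨x, hxk⟩ = e 1 := by rw [← this]; simp
  exact congrArg Subtype.val (he h3)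

theorem isPGroup_wreath {p : ℕ} (hp : p.Prime) [Finite D] [Finite U] (hD : IsPGroup p D)
    (hU : IsPGroup p U) : IsPGroup p (D ≀ᵣ U) := by
  have := Fact.mk hp
  obtain ⟨a, ha⟩ := IsPGroup.iff_card.1 hD
  obtain ⟨b, hb⟩ := IsPGroup.iff_card.1 hU
  refine IsPGroup.of_card (n := a * Nat.card U + b) ?_
  rw [RegularWreathProduct.card, ha, hb, pow_add, pow_mul]

end Wreath

/-! ### Higman's theorem for a cyclic amalgamated subgroup. -/

section PGroups

variable {p : ℕ} (hp : p.Prime)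
include hp

theorem exists_hom_zpowers {P : Type*} [Group P] {z : P} (hz : orderOf z = p) :
    ∃ e : Subgroup.zpowers z →* Multiplicative (ZMod p), Function.Injective e ∧
      ∀ h, e ⟨z, h⟩ = Multiplicative.ofAdd 1 := by
  have := Fact.mk hp
  have h1 : ∀ x : Subgroup.zpowers z, x ∈ Subgroup.zpowers
      (⟨z, Subgroup.mem_zpowers z⟩ : Subgroup.zpowers z) := by
    rintro ⟨x, k, rfl⟩
    exact ⟨k, by ext; simp⟩
  have h2 : ∀ x : Multiplicative (ZMod p), x ∈ Subgroup.zpowers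
      (Multiplicative.ofAdd (1 : ZMod p)) := by
    intro x
    refine ⟨((Multiplicative.toAdd x).val : ℤ), ?_⟩
    change Multiplicative.ofAdd (1 : ZMod p) ^ _ = _
    rw [← ofAdd_zsmul]
    simp
  have h3 : orderOf (⟨z, Subgroup.mem_zpowers z⟩ : Subgroup.zpowers z) =
      orderOf (Multiplicative.ofAdd (1 : ZMod p)) := by
    rw [Subgroup.orderOf_mk, hz, orderOf_ofAdd_eq_addOrderOf, ZMod.addOrderOf_one]
  exact ⟨(mulEquivOfOrderOfEq h1 h2 h3).toMonoidHom, (mulEquivOfOrderOfEq h1 h2 h3).injective,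
    fun _ => mulEquivOfOrderOfEq_apply_gen h1 h2 h3⟩

theorem exists_central_orderOf_eq {P : Type*} [Group P] [Finite P] [Nontrivial P]
    (hP : IsPGroup p P) : ∃ z ∈ Subgroup.center P, orderOf z = p := by
  have := Fact.mk hp
  have hnt := hP.center_nontrivial
  obtain ⟨x, hx⟩ := exists_prime_orderOf_dvd_card' (G := Subgroup.center P) p (by
    rcases (hP.to_subgroup (Subgroup.center P)).card_eq_or_dvd with h | h
    · exact absurd h (Finite.one_lt_card_iff_nontrivial.2 hnt).ne'
    · exact h)
  exact ⟨x, x.2, by rw [Subgroup.orderOf_coe, hx]⟩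

theorem exists_central_quotient {P : Type u} [Group P] [Finite P] (hP : IsPGroup p P) {z : P}
    (hz : z ∈ Subgroup.center P) (hzp : orderOf z = p) :
    ∃ (P' : Type u) (_ : Group P') (_ : Finite P') (π : P →* P'), IsPGroup p P' ∧
      Nat.card P' < Nat.card P ∧ π.ker = Subgroup.zpowers z := by
  have hN : (Subgroup.zpowers z).Normal := by
    refine ⟨fun n hn g => ?_⟩
    have := Subgroup.mem_center_iff.1 ((Subgroup.zpowers_le.2 hz) hn) g
    rw [this]; simpa using hn
  refine ⟨P ⧸ Subgroup.zpowers z, inferInstance, inferInstance, QuotientGroup.mk' _,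
    hP.to_quotient _, ?_, QuotientGroup.ker_mk' _⟩
  rw [Subgroup.card_eq_card_quotient_mul_card_subgroup (Subgroup.zpowers z), Nat.card_zpowers, hzp]
  exact lt_mul_of_one_lt_right Nat.card_pos hp.one_lt

/-- Images of an element of a finite `p`-group realize all smaller powers of `p` as orders. -/
theorem exists_hom_orderOf_eq {Q : Type u} [Group Q] [Finite Q] (hQ : IsPGroup p Q) (d : Q)
    {k m : ℕ} (hd : orderOf d = p ^ m) (hk : k ≤ m) :
    ∃ (Q' : Type u) (_ : Group Q') (_ : Finite Q') (π : Q →* Q'), IsPGroup p Q' ∧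
      orderOf (π d) = p ^ k := by
  have := Fact.mk hp
  induction hN : Nat.card Q using Nat.strong_induction_on generalizing Q m with
  | _ N ih =>
    rcases hk.eq_or_lt with rfl | hlt
    · exact ⟨Q, inferInstance, inferInstance, MonoidHom.id Q, hQ, hd⟩
    · have hnt : Nontrivial Q := by
        refine ⟨d, 1, fun h => ?_⟩
        rw [h, orderOf_one] at hd
        exact (Nat.one_lt_pow (by omega) hp.one_lt).ne hd
      obtain ⟨z, hz, hzp⟩ := exists_central_orderOf_eq hp hQ
      obtain ⟨Q', _, _, π, hQ', hcard, hker⟩ := exists_central_quotient hp hQ hz hzp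
      obtain ⟨m', hm'⟩ := IsPGroup.iff_orderOf.1 hQ' (π d)
      have h1 : d ^ p ^ m' ∈ Subgroup.zpowers z := by
        rw [← hker, MonoidHom.mem_ker, map_pow, ← hm', pow_orderOf_eq_one]
      obtain ⟨j, hj⟩ := h1
      have hj : z ^ j = d ^ p ^ m' := hj
      have h2 : d ^ p ^ (m' + 1) = 1 := by
        rw [pow_succ, pow_mul, ← hj, ← zpow_natCast, zpow_comm, zpow_natCast, ← hzp,
          pow_orderOf_eq_one, one_zpow]
      rw [← orderOf_dvd_iff_pow_eq_one, hd, Nat.pow_dvd_pow_iff_le_right hp.one_lt] at h2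
      -- The central quotient lowers the order of `d` by a factor of at most `p`, so the exponent
      -- cannot drop below `k`.
      obtain ⟨Q'', _, _, π', hQ'', h3⟩ := ih _ (hN ▸ hcard) hQ' (π d) hm' (by omega) rfl
      exact ⟨Q'', _, ‹_›, π'.comp π, hQ'', h3⟩

/-- The inductive step of Higman's theorem, for a central subgroup missing `⟨c⟩`. -/
theorem exists_overgroup_of_notMem {P P' Q U : Type u} [Group P] [Group P'] [Group Q] [Group U]
    [Finite U] (hU : IsPGroup p U) {z c : P} {d : Q} (hz : z ∈ Subgroup.center P)
    (hzp : orderOf z = p) (hcd : orderOf c = orderOf d)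
    (π : P →* P') (hker : π.ker = Subgroup.zpowers z) (ι₁ : P' →* U) (ι₂ : Q →* U)
    (h₁ : Function.Injective ι₁) (h₂ : Function.Injective ι₂) (hι : ι₁ (π c) = ι₂ d) :
    ∃ (W : Type u) (_ : Group W) (_ : Finite W) (κ₁ : P →* W) (κ₂ : Q →* W), IsPGroup p W ∧
      Function.Injective κ₁ ∧ Function.Injective κ₂ ∧ κ₁ c = κ₂ d := by
  have := Fact.mk hp
  obtain ⟨e, he, -⟩ := exists_hom_zpowers hp hzp
  have hker' : (ι₁.comp π).ker = Subgroup.zpowers z := by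
    rw [← hker]; ext x; simp [MonoidHom.mem_ker, (injective_iff_map_eq_one' _).1 h₁]
  obtain ⟨Θ, hΘ1, hΘ2⟩ := exists_wreath_hom (ι₁.comp π) hz hker' e
  obtain ⟨w, hw, hconj⟩ := exists_conj_wreath (Θ c) (RegularWreathProduct.inl (ι₂ d))
    (by rw [hΘ1]; exact hι) (by
      have h : orderOf (Θ c).right = orderOf d := by
        rw [hΘ1, MonoidHom.comp_apply, hι, orderOf_injective _ h₂]
      rw [h]
      conv_lhs => rw [← hcd]
      rw [← map_pow, ← map_pow, ← map_pow, pow_orderOf_eq_one, pow_orderOf_eq_one]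
      simp)
  refine ⟨Multiplicative (ZMod p) ≀ᵣ U, inferInstance, inferInstance,
    (MulAut.conj w).toMonoidHom.comp Θ, RegularWreathProduct.inl.comp ι₂,
    isPGroup_wreath hp (IsPGroup.of_card (n := 1) (by simp)) hU, ?_, ?_, hconj⟩
  · exact (MulAut.conj w).injective.comp (wreath_hom_injective _ hker' e he Θ hΘ1 hΘ2)
  · exact fun x y hxy => h₂ (congrArg RegularWreathProduct.right hxy)

/-- The inductive step of Higman's theorem, for the subgroups of order `p` of the amalgamated
cyclic subgroups. -/
theorem exists_overgroup_of_pow_eq {P P' Q Q' U : Type u} [Group P] [Group P'] [Group Q]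
    [Group Q'] [Group U] [Finite U] (hU : IsPGroup p U) {z c : P} {y d : Q}
    (hz : z ∈ Subgroup.center P) (hy : y ∈ Subgroup.center Q)
    (hzp : orderOf z = p) (hyp : orderOf y = p)
    (π : P →* P') (hker : π.ker = Subgroup.zpowers z)
    (ρ : Q →* Q') (hkerρ : ρ.ker = Subgroup.zpowers y)
    (hcz : c ^ orderOf (π c) = z) (hdy : d ^ orderOf (π c) = y) (ι₁ : P' →* U) (ι₂ : Q' →* U)
    (h₁ : Function.Injective ι₁) (h₂ : Function.Injective ι₂) (hι : ι₁ (π c) = ι₂ (ρ d)) :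
    ∃ (W : Type u) (_ : Group W) (_ : Finite W) (κ₁ : P →* W) (κ₂ : Q →* W), IsPGroup p W ∧
      Function.Injective κ₁ ∧ Function.Injective κ₂ ∧ κ₁ c = κ₂ d := by
  have := Fact.mk hp
  obtain ⟨e, he, hez⟩ := exists_hom_zpowers hp hzp
  obtain ⟨e', he', hey⟩ := exists_hom_zpowers hp hyp
  have hk1 : (ι₁.comp π).ker = Subgroup.zpowers z := by
    rw [← hker]; ext x; simp [MonoidHom.mem_ker, (injective_iff_map_eq_one' _).1 h₁]
  have hk2 : (ι₂.comp ρ).ker = Subgroup.zpowers y := by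
    rw [← hkerρ]; ext x; simp [MonoidHom.mem_ker, (injective_iff_map_eq_one' _).1 h₂]
  obtain ⟨Θ, hΘ1, hΘ2⟩ := exists_wreath_hom (ι₁.comp π) hz hk1 e
  obtain ⟨Ξ, hΞ1, hΞ2⟩ := exists_wreath_hom (ι₂.comp ρ) hy hk2 e'
  obtain ⟨w, hw, hconj⟩ := exists_conj_wreath (Θ c) (Ξ d)
    (by rw [hΘ1, hΞ1]; exact hι) (by
      have h : orderOf (Θ c).right = orderOf (π c) := by
        rw [hΘ1, MonoidHom.comp_apply, orderOf_injective _ h₁]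
      rw [h, ← map_pow, ← map_pow, hcz, hdy]
      ext u
      · have h3 := hΘ2 ⟨z, Subgroup.mem_zpowers z⟩ u
        have h4 := hΞ2 ⟨y, Subgroup.mem_zpowers y⟩ u
        rw [hez] at h3
        rw [hey] at h4
        exact h3.trans h4.symm
      · have h3 : z ∈ (ι₁.comp π).ker := hk1 ▸ Subgroup.mem_zpowers z
        have h4 : y ∈ (ι₂.comp ρ).ker := hk2 ▸ Subgroup.mem_zpowers y
        rw [hΘ1, hΞ1, MonoidHom.mem_ker.1 h3, MonoidHom.mem_ker.1 h4])
  refine ⟨Multiplicative (ZMod p) ≀ᵣ U, inferInstance, inferInstance,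
    (MulAut.conj w).toMonoidHom.comp Θ, Ξ,
    isPGroup_wreath hp (IsPGroup.of_card (n := 1) (by simp)) hU, ?_,
    wreath_hom_injective _ hk2 e' he' Ξ hΞ1 hΞ2, hconj⟩
  exact (MulAut.conj w).injective.comp (wreath_hom_injective _ hk1 e he Θ hΘ1 hΘ2)

/-- A kernel of prime order not contained in `⟨c⟩` meets it trivially. -/
theorem orderOf_map_of_notMem {P P' : Type*} [Group P] [Group P'] {z c : P} (hzp : orderOf z = p)
    (hzc : z ∉ Subgroup.zpowers c) (π : P →* P') (hker : π.ker = Subgroup.zpowers z) :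
    orderOf (π c) = orderOf c := by
  refine Nat.dvd_antisymm (orderOf_map_dvd π c) ?_
  have h1 : c ^ orderOf (π c) ∈ Subgroup.zpowers z := by
    rw [← hker, MonoidHom.mem_ker, map_pow, pow_orderOf_eq_one]
  obtain ⟨j, hj⟩ := h1
  have hj : z ^ j = c ^ orderOf (π c) := hj
  rw [orderOf_dvd_iff_pow_eq_one, ← hj, ← orderOf_dvd_iff_zpow_eq_one, hzp]
  by_contra h
  have h2 : z ∈ Subgroup.zpowers (z ^ j) := by
    rw [mem_zpowers_zpow_iff, hzp, Int.gcd_eq_natAbs, Int.natAbs_natCast]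
    refine Nat.Coprime.symm ?_
    rwa [hp.coprime_iff_not_dvd, ← Int.natCast_dvd]
  rw [hj] at h2
  exact hzc (Subgroup.zpowers_le.2 (Subgroup.pow_mem _ (Subgroup.mem_zpowers c) _) h2)

/-- If `⟨c⟩` contains a central subgroup of order `p`, it is generated by a power of `c`. -/
theorem pow_mem_center {P : Type*} [Group P] (hP : IsPGroup p P) {z c : P} {n : ℕ}
    (hz : z ∈ Subgroup.center P) (hzp : orderOf z = p) (hzc : z ∈ Subgroup.zpowers c)
    (hc : orderOf c = p ^ (n + 1)) : c ^ p ^ n ∈ Subgroup.center P := by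
  obtain ⟨k, rfl⟩ := hzc
  change orderOf (c ^ k) = p at hzp
  have h1 : (c ^ k) ^ p = 1 := by rw [← hzp, pow_orderOf_eq_one]
  rw [← zpow_natCast, ← zpow_mul, ← orderOf_dvd_iff_zpow_eq_one, hc, pow_succ, Nat.cast_mul] at h1
  obtain ⟨j, rfl⟩ := Int.dvd_of_mul_dvd_mul_right (by exact_mod_cast hp.ne_zero) h1
  have h2 : ¬ (p : ℤ) ∣ j := by
    rintro ⟨l, rfl⟩
    have : c ^ (((p ^ n : ℕ) : ℤ) * (p * l)) = 1 := by
      rw [← orderOf_dvd_iff_zpow_eq_one, hc, pow_succ]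
      exact ⟨l, by push_cast; ring⟩
    rw [this, orderOf_one] at hzp
    exact hp.one_lt.ne hzp
  have h3 := mem_zpowers_zpow_of_isPGroup hp hP (c ^ p ^ n) h2
  rw [← zpow_natCast, ← zpow_mul] at h3
  rw [← zpow_natCast]
  exact Subgroup.zpowers_le.2 hz h3

/-- Higman's theorem for a cyclic amalgamated subgroup: two finite `p`-groups with chosen elements
of the same order embed in a common finite `p`-group in which the chosen elements coincide. -/
theorem exists_overgroup {P Q : Type u} [Group P] [Group Q] [Finite P] [Finite Q]
    (hP : IsPGroup p P) (hQ : IsPGroup p Q) (c : P) (d : Q) (hcd : orderOf c = orderOf d) :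
    ∃ (W : Type u) (_ : Group W) (_ : Finite W) (κ₁ : P →* W) (κ₂ : Q →* W), IsPGroup p W ∧
      Function.Injective κ₁ ∧ Function.Injective κ₂ ∧ κ₁ c = κ₂ d := by
  have := Fact.mk hp
  induction hN : Nat.card P + Nat.card Q using Nat.strong_induction_on generalizing P Q with
  | _ N ih =>
  by_cases hA : ∃ z ∈ Subgroup.center P, orderOf z = p ∧ z ∉ Subgroup.zpowers c
  · obtain ⟨z, hz, hzp, hzc⟩ := hA
    obtain ⟨P', _, _, π, hP', hcard, hker⟩ := exists_central_quotient hp hP hz hzp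
    obtain ⟨U, _, _, ι₁, ι₂, hU, h₁, h₂, hι⟩ := ih _ (by omega) hP' hQ (π c) d
      ((orderOf_map_of_notMem hp hzp hzc π hker).trans hcd) rfl
    exact exists_overgroup_of_notMem hp hU hz hzp hcd π hker ι₁ ι₂ h₁ h₂ hι
  by_cases hB : ∃ z ∈ Subgroup.center Q, orderOf z = p ∧ z ∉ Subgroup.zpowers d
  · obtain ⟨z, hz, hzp, hzc⟩ := hB
    obtain ⟨Q', _, _, π, hQ', hcard, hker⟩ := exists_central_quotient hp hQ hz hzp
    obtain ⟨U, _, _, ι₁, ι₂, hU, h₁, h₂, hι⟩ := ih _ (by omega) hP hQ' c (π d)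
      (hcd.trans (orderOf_map_of_notMem hp hzp hzc π hker).symm) rfl
    obtain ⟨W, iW, iF, κ₁, κ₂, hW, hκ₁, hκ₂, hκ⟩ :=
      exists_overgroup_of_notMem hp hU hz hzp hcd.symm π hker ι₂ ι₁ h₂ h₁ hι.symm
    exact ⟨W, iW, iF, κ₂, κ₁, hW, hκ₂, hκ₁, hκ.symm⟩
  -- From here on, every central subgroup of order `p` lies in `⟨c⟩`, respectively `⟨d⟩`. The bottom
  -- layers of these two cyclic groups are therefore central and can be factored out simultaneously.
  push Not at hA hB
  obtain ⟨n, hn⟩ := IsPGroup.iff_orderOf.1 hP c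
  have trivial_of : ∀ {R : Type u} [Group R] [Finite R] (_ : IsPGroup p R) (x : R),
      orderOf x = 1 → (∀ z ∈ Subgroup.center R, orderOf z = p → z ∈ Subgroup.zpowers x) →
      Subsingleton R := by
    intro R _ _ hR x hx hall
    by_contra hnt
    rw [not_subsingleton_iff_nontrivial] at hnt
    obtain ⟨z, hz, hzp⟩ := exists_central_orderOf_eq hp hR
    have := hall z hz hzp
    rw [orderOf_eq_one_iff.1 hx, Subgroup.zpowers_one_eq_bot, Subgroup.mem_bot] at this
    rw [this, orderOf_one] at hzp
    exact hp.one_lt.ne hzp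
  rcases n with _ | n
  · have hP1 := trivial_of hP c (by simpa using hn) hA
    have hQ1 := trivial_of hQ d (by rw [← hcd]; simpa using hn) hB
    exact ⟨P, inferInstance, inferInstance, MonoidHom.id P, 1, hP, Function.injective_id,
      Function.injective_of_subsingleton _, Subsingleton.elim _ _⟩
  have central : ∀ {R : Type u} [Group R] [Finite R] (_ : IsPGroup p R) (x : R),
      orderOf x = p ^ (n + 1) →
      (∀ z ∈ Subgroup.center R, orderOf z = p → z ∈ Subgroup.zpowers x) →
      x ^ p ^ n ∈ Subgroup.center R ∧ orderOf (x ^ p ^ n) = p := by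
    intro R _ _ hR x hx hall
    have hnt : Nontrivial R := by
      refine ⟨x, 1, fun h => ?_⟩
      rw [h, orderOf_one] at hx
      exact (Nat.one_lt_pow (by omega) hp.one_lt).ne hx
    obtain ⟨z, hz, hzp⟩ := exists_central_orderOf_eq hp hR
    refine ⟨pow_mem_center hp hR hz hzp (hall z hz hzp) hx, ?_⟩
    rw [orderOf_pow_of_dvd (pow_pos hp.pos n).ne' (by rw [hx, pow_succ]; exact dvd_mul_right _ _),
      hx, pow_succ, Nat.mul_div_cancel_left _ (pow_pos hp.pos n)]
  have order_map : ∀ {R R' : Type u} [Group R] [Group R'] (x : R) (π : R →* R'),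
      orderOf x = p ^ (n + 1) → π.ker = Subgroup.zpowers (x ^ p ^ n) → orderOf (π x) = p ^ n := by
    intro R R' _ _ x π hx hk
    refine Nat.dvd_antisymm ?_ ?_
    · rw [orderOf_dvd_iff_pow_eq_one, ← map_pow, ← MonoidHom.mem_ker, hk]
      exact Subgroup.mem_zpowers _
    · have h1 : x ^ orderOf (π x) ∈ Subgroup.zpowers (x ^ p ^ n) := by
        rw [← hk, MonoidHom.mem_ker, map_pow, pow_orderOf_eq_one]
      obtain ⟨j, hj⟩ := h1
      have hj : (x ^ p ^ n) ^ j = x ^ orderOf (π x) := hj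
      rw [← zpow_natCast, ← zpow_natCast, ← zpow_mul] at hj
      have h2 : x ^ (((p ^ n : ℕ) : ℤ) * j - (orderOf (π x) : ℕ)) = 1 := by
        rw [zpow_sub, hj, mul_inv_cancel]
      rw [← orderOf_dvd_iff_zpow_eq_one, hx] at h2
      have h3 : ((p ^ n : ℕ) : ℤ) ∣ ((p ^ n : ℕ) : ℤ) * j - (orderOf (π x) : ℕ) :=
        (Int.natCast_dvd_natCast.2 (pow_dvd_pow p n.le_succ)).trans h2
      have h4 := dvd_sub (dvd_mul_right ((p ^ n : ℕ) : ℤ) j) h3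
      rw [sub_sub_cancel] at h4
      exact_mod_cast h4
  obtain ⟨hz, hzp⟩ := central hP c hn hA
  obtain ⟨hy, hyp⟩ := central hQ d (hcd ▸ hn) hB
  obtain ⟨P', _, _, π, hP', hcard, hker⟩ := exists_central_quotient hp hP hz hzp
  obtain ⟨Q', _, _, ρ, hQ', hcard', hkerρ⟩ := exists_central_quotient hp hQ hy hyp
  have hπ := order_map c π hn hker
  have hρ := order_map d ρ (hcd ▸ hn) hkerρ
  obtain ⟨U, _, _, ι₁, ι₂, hU, h₁, h₂, hι⟩ := ih _ (by omega) hP' hQ' (π c) (ρ d)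
    (hπ.trans hρ.symm) rfl
  exact exists_overgroup_of_pow_eq hp hU hz hy hzp hyp π hker ρ hkerρ (by rw [hπ]) (by rw [hπ])
    ι₁ ι₂ h₁ h₂ hι

end PGroups

/-! ### A unipotent representation on truncated paths. -/

section PathModule

variable {P : Type u} [Group P]

/-- The right coset of an element. -/
def rightCoset (D : Subgroup P) (x : P) : Quotient (QuotientGroup.rightRel D) := Quotient.mk _ x

theorem rightCoset_eq_iff {D : Subgroup P} {x y : P} :
    rightCoset D x = rightCoset D y ↔ y * x⁻¹ ∈ D := by
  rw [rightCoset, rightCoset, Quotient.eq, QuotientGroup.rightRel_apply]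

/-- Index set of the module of truncated paths: a list of at most `n` right cosets, and an element
of the group. -/
abbrev PathIndex (D : Subgroup P) (n : ℕ) : Type u :=
  {L : List (Quotient (QuotientGroup.rightRel D)) // L.length ≤ n} × P

/-- The module of functions on truncated paths. -/
abbrev PathModule (p : ℕ) (D : Subgroup P) (n : ℕ) : Type u := PathIndex D n → ZMod p

/-- The endomorphism ring of the module of truncated paths. -/
abbrev PathEnd (p : ℕ) (D : Subgroup P) (n : ℕ) : Type u :=
  Module.End (ZMod p) (PathModule p D n)

open Classical in
/-- The function underlying `pathShift`. -/
noncomputable def pathShiftFun {p : ℕ} {D : Subgroup P} {n : ℕ} (v : PathModule p D n) :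
    PathModule p D n
  | (⟨[], _⟩, _) => 0
  | (⟨q :: L, h⟩, u) =>
    if q = rightCoset D u ∧ L.head? ≠ some (rightCoset D u) then
      v (⟨L, (Nat.le_succ _).trans h⟩, u) else 0

/-- The square-zero endomorphism that extends a path at `u` by the coset of `u`. -/
noncomputable def pathShift (p : ℕ) (D : Subgroup P) (n : ℕ) :
    PathEnd p D n where
  toFun := pathShiftFun
  map_add' v w := by
    ext ⟨⟨L, h⟩, u⟩
    cases L with
    | nil => simp [pathShiftFun]
    | cons q L => simp only [pathShiftFun, Pi.add_apply]; split_ifs <;> simp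
  map_smul' c v := by
    ext ⟨⟨L, h⟩, u⟩
    cases L with
    | nil => simp [pathShiftFun]
    | cons q L => simp only [pathShiftFun, Pi.smul_apply]; split_ifs <;> simp

/-- The action of the group on the module of paths. -/
def pathAction (p : ℕ) (D : Subgroup P) (n : ℕ) : P →* PathEnd p D n where
  toFun x :=
    { toFun := fun v i => v (i.1, x⁻¹ * i.2)
      map_add' := fun _ _ => rfl
      map_smul' := fun _ _ => rfl }
  map_one' := by ext; simp
  map_mul' x y := by
    ext v i
    simp [mul_assoc]

variable {p : ℕ} {D : Subgroup P} {n : ℕ}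

open Classical in
theorem pathShift_cons (v : PathModule p D n) (q L h) (u : P) :
    pathShift p D n v (⟨q :: L, h⟩, u) =
      if q = rightCoset D u ∧ L.head? ≠ some (rightCoset D u) then
        v (⟨L, (Nat.le_succ _).trans h⟩, u) else 0 := rfl

theorem pathAction_apply (x : P) (v : PathModule p D n) (L u) :
    pathAction p D n x v (L, u) = v (L, x⁻¹ * u) := rfl

/-- A path extended at `u` begins with the coset of `u`, and the condition on the head forbids
extending it at `u` again. -/
theorem pathShift_mul_self : pathShift p D n * pathShift p D n = 0 := by
  ext v ⟨⟨L, h⟩, u⟩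
  rw [Module.End.mul_apply]
  cases L with
  | nil => rfl
  | cons q L =>
    rw [pathShift_cons]
    split_ifs with hq
    · cases L with
      | nil => rfl
      | cons q' L =>
        rw [pathShift_cons, if_neg]
        · rfl
        · rintro ⟨h1, -⟩
          exact hq.2 (by simp [h1])
    · rfl

/-- The shift sees `u` only through its right coset, which left translation by `D` preserves. Thus
conjugation by `pathUnit` fixes the action of `D`, so the two actions can be glued over it. -/
theorem pathShift_comm {d : P} (hd : d ∈ D) :
    pathShift p D n * pathAction p D n d = pathAction p D n d * pathShift p D n := by
  ext v ⟨⟨L, h⟩, u⟩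
  rw [Module.End.mul_apply, Module.End.mul_apply, pathAction_apply]
  cases L with
  | nil => rfl
  | cons q L =>
    have : rightCoset D (d⁻¹ * u) = rightCoset D u := by
      rw [rightCoset_eq_iff]; simpa using hd
    rw [pathShift_cons, pathShift_cons, this, pathAction_apply]

/-- The unipotent automorphism of the module of paths. -/
noncomputable def pathUnit (p : ℕ) (D : Subgroup P) (n : ℕ) :
    (PathEnd p D n)ˣ where
  val := 1 + pathShift p D n
  inv := 1 - pathShift p D n
  val_inv := by
    have := pathShift_mul_self (p := p) (D := D) (n := n)
    rw [add_mul, mul_sub, mul_sub, this]; simp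
  inv_val := by
    have := pathShift_mul_self (p := p) (D := D) (n := n)
    rw [sub_mul, mul_add, mul_add, this]; simp

/-- The functions vanishing on paths of length less than `k`. -/
def pathFiltration (p : ℕ) (D : Subgroup P) (n k : ℕ) : Set (PathModule p D n) :=
  {v | ∀ L u, L.1.length < k → v (L, u) = 0}

/-- The endomorphisms raising the filtration by at least `s`. -/
def Raises (s : ℕ) (J : PathEnd p D n) : Prop :=
  ∀ k, ∀ v ∈ pathFiltration p D n k, J v ∈ pathFiltration p D n (k + s)

theorem Raises.add {s : ℕ} {J J' : PathEnd p D n} (h : Raises s J)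
    (h' : Raises s J') : Raises s (J + J') := fun k v hv L u hL => by
  rw [LinearMap.add_apply, Pi.add_apply, h k v hv L u hL, h' k v hv L u hL, add_zero]

theorem Raises.neg {s : ℕ} {J : PathEnd p D n} (h : Raises s J) :
    Raises s (-J) := fun k v hv L u hL => by
  rw [LinearMap.neg_apply, Pi.neg_apply, h k v hv L u hL, neg_zero]

theorem Raises.mul {s t : ℕ} {J J' : PathEnd p D n} (h : Raises s J)
    (h' : Raises t J') : Raises (s + t) (J * J') := fun k v hv => by
  have := h _ _ (h' k v hv)
  rwa [add_assoc, add_comm t s] at this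

theorem Raises.mono {s t : ℕ} (hst : s ≤ t) {J : PathEnd p D n}
    (h : Raises t J) : Raises s J := fun k v hv L u hL => h k v hv L u (by omega)

theorem raises_pathAction (x : P) : Raises 0 (pathAction p D n x) :=
  fun _ _ hv L _ hL => hv L _ hL

theorem raises_pathShift : Raises 1 (pathShift p D n) := by
  rintro k v hv ⟨L, h⟩ u hL
  cases L with
  | nil => rfl
  | cons q L =>
    rw [pathShift_cons]
    split_ifs
    · exact hv ⟨L, _⟩ u (by simpa using hL)
    · rfl

/-- The action of the group conjugated by the unipotent automorphism. -/
noncomputable def pathConj (p : ℕ) (D : Subgroup P) (n : ℕ) (x : P) : PathEnd p D n :=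
  (1 + pathShift p D n) * pathAction p D n x * (1 - pathShift p D n)

/-- After expansion, every term other than the plain translation contains a shift. -/
theorem raises_pathConj_sub (x : P) : Raises 1 (pathConj p D n x - pathAction p D n x) := by
  have e : pathConj p D n x - pathAction p D n x =
      pathShift p D n * pathAction p D n x + -(pathAction p D n x * pathShift p D n) +
        -(pathShift p D n * pathAction p D n x * pathShift p D n) := by
    rw [pathConj]
    simp only [mul_sub, add_mul, one_mul, mul_one]
    abel
  rw [e]
  have h1 : Raises 1 (pathShift p D n * pathAction p D n x) :=
    raises_pathShift.mul (raises_pathAction x)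
  have h2 : Raises 1 (pathAction p D n x * pathShift p D n) :=
    ((raises_pathAction x).mul raises_pathShift).mono (by simp)
  exact (h1.add h2.neg).add ((h1.mul raises_pathShift).mono (by simp)).neg

theorem Raises.pow {J : PathEnd p D n} (h : Raises 1 J) (m : ℕ) :
    Raises m (J ^ m) := by
  induction m with
  | zero => exact fun _ _ hv => hv
  | succ m ih => rw [pow_succ]; exact ih.mul h

theorem Raises.eq_zero {J : PathEnd p D n} {m : ℕ} (h : Raises m J)
    (hm : n < m) : J = 0 := by
  ext v ⟨L, u⟩
  exact h 0 v (fun _ _ hL => absurd hL (Nat.not_lt_zero _)) L u (by have := L.2; omega)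

/-- A unipotent endomorphism of the module of paths has `p`-power order. -/
theorem exists_one_add_pow_eq_one (hp : p.Prime) {J : PathEnd p D n}
    (h : Raises 1 J) : ∃ b, (1 + J) ^ p ^ b = 1 := by
  have := Fact.mk hp
  obtain ⟨b, hb⟩ : ∃ b, n < p ^ b := ⟨n, Nat.lt_pow_self hp.one_lt⟩
  have : CharP (PathEnd p D n) p := by
    have : Nonempty (PathIndex D n) := ⟨(⟨[], by simp⟩, 1)⟩
    exact charP_of_injective_algebraMap (algebraMap (ZMod p) _).injective p
  refine ⟨b, ?_⟩
  -- In characteristic `p` this power is `1 + J ^ p ^ b`, and `J ^ p ^ b` raises the filtration past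
  -- the maximal length `n`.
  rw [add_pow_char_pow_of_commute p _ (Commute.one_left J), one_pow, (h.pow _).eq_zero hb,
    add_zero]

instance [Finite P] : Finite (PathIndex D n) := by
  have : Finite {L : List (Quotient (QuotientGroup.rightRel D)) // L.length ≤ n} :=
    (List.finite_length_le _ n).to_subtype
  infer_instance

theorem finite_end [Finite P] [NeZero p] : Finite (PathEnd p D n) :=
  DFunLike.finite _

open Classical in
/-- `v` is `ε` at the path `(L, x)` and vanishes at all other paths with the same list and at all
longer paths. -/
def HasLeading (v : PathModule p D n) (L : List (Quotient (QuotientGroup.rightRel D))) (x : P)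
    (ε : ZMod p) : Prop :=
  (∀ h u, v (⟨L, h⟩, u) = if u = x then ε else 0) ∧
    ∀ L' h u, L.length < L'.length → v (⟨L', h⟩, u) = 0

theorem HasLeading.action {v : PathModule p D n} {L x ε} (h : HasLeading v L x ε) (b : P) :
    HasLeading (pathAction p D n b v) L (b * x) ε := by
  refine ⟨fun hL u => ?_, fun L' hL' u hlt => h.2 L' hL' _ hlt⟩
  rw [pathAction_apply, h.1]
  congr 1
  rw [inv_mul_eq_iff_eq_mul]

theorem HasLeading.add_smul_shift {v : PathModule p D n} {L x ε} (h : HasLeading v L x ε)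
    (hL : L.head? ≠ some (rightCoset D x)) (σ : ZMod p) :
    HasLeading (v + σ • pathShift p D n v) (rightCoset D x :: L) x (σ * ε) := by
  refine ⟨fun hl u => ?_, fun L' hL' u hlt => ?_⟩
  · rw [Pi.add_apply, Pi.smul_apply, h.2 _ _ _ (by simp), zero_add, pathShift_cons, h.1]
    by_cases hu : u = x
    · subst hu; simp [hL]
    · simp [hu]
  · rw [Pi.add_apply, Pi.smul_apply, h.2 _ _ _ (by simp at hlt; omega), zero_add]
    cases L' with
    | nil => simp at hlt
    | cons q L' =>
      rw [pathShift_cons]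
      split_ifs
      · rw [h.2 _ _ _ (by simpa using hlt), smul_zero]
      · simp

/-- The inner factor prepends the coset of `x` with a minus sign and translation moves the endpoint
to `b * x`. Since `b ∉ D` this is a new coset, so the outer factor can prepend it. -/
theorem HasLeading.conj {v : PathModule p D n} {L x ε} (h : HasLeading v L x ε)
    (hL : L.head? ≠ some (rightCoset D x)) {b : P} (hb : b ∉ D) :
    HasLeading (pathConj p D n b v)
      (rightCoset D (b * x) :: rightCoset D x :: L) (b * x) (-ε) := by
  have h1 := (h.add_smul_shift hL (-1)).action b
  have h2 := h1.add_smul_shift (by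
    simp only [List.head?_cons, ne_eq, Option.some.injEq, rightCoset_eq_iff]
    simpa using hb) 1
  convert h2 using 1
  · change (1 + pathShift p D n) (pathAction p D n b ((1 - pathShift p D n) v)) = _
    simp [sub_eq_add_neg]
  · ring

end PathModule

/-! ### Closedness of the amalgamated subgroup. -/

section SeparableBase

variable {G : Type u} [Group G] {S : ZMod 2 → Subgroup G} {C : Subgroup G}

/-- The representation of an amalgam on the module of paths. -/
theorem IsAmalgam.exists_path_hom (hS : IsAmalgam S C) {P : Type u} [Group P] (ψ : G →* P)
    (p n : ℕ) :
    ∃ Ψ : G →* (PathEnd p (C.map ψ) n)ˣ,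
      (∀ a ∈ S 0, (Ψ a : PathEnd p (C.map ψ) n) =
        pathAction p (C.map ψ) n (ψ a)) ∧
      ∀ b ∈ S 1, (Ψ b : PathEnd p (C.map ψ) n) =
        pathConj p (C.map ψ) n (ψ b) := by
  let ρ : G →* (PathEnd p (C.map ψ) n)ˣ :=
    (pathAction p (C.map ψ) n).toHomUnits.comp ψ
  let t := pathUnit p (C.map ψ) n
  obtain ⟨Ψ, hΨ⟩ := hS.exists_lift (U := (PathEnd p (C.map ψ) n)ˣ)
    (fun i => if i = 0 then ρ.comp (S i).subtype
      else ((MulAut.conj t).toMonoidHom.comp ρ).comp (S i).subtype) (by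
      intro c h0 h1 hc
      simp only [↓reduceIte, one_ne_zero]
      change ρ c = t * ρ c * t⁻¹
      rw [eq_mul_inv_iff_mul_eq]
      ext1
      change pathAction p (C.map ψ) n (ψ c) * (1 + pathShift p (C.map ψ) n) =
        (1 + pathShift p (C.map ψ) n) * pathAction p (C.map ψ) n (ψ c)
      rw [mul_add, add_mul, pathShift_comm (Subgroup.mem_map_of_mem ψ hc), mul_one, one_mul])
  refine ⟨Ψ, fun a ha => ?_, fun b hb => ?_⟩
  · rw [hΨ 0 ⟨a, ha⟩]; rfl
  · rw [hΨ 1 ⟨b, hb⟩]; rfl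

/-- Each `Ψ g` is translation by `ψ g` up to an operator raising the filtration. A `p`-power of `g`
that dies under `ψ` therefore acts unipotently, hence with `p`-power order. -/
theorem isPGroup_path_range {p : ℕ} (hp : p.Prime) (hS : IsAmalgam S C) {P : Type u} [Group P]
    (hP : IsPGroup p P) (ψ : G →* P) {n : ℕ}
    (Ψ : G →* (PathEnd p (C.map ψ) n)ˣ)
    (h0 : ∀ a ∈ S 0, (Ψ a : PathEnd p (C.map ψ) n) =
        pathAction p (C.map ψ) n (ψ a))
    (h1 : ∀ b ∈ S 1, (Ψ b : PathEnd p (C.map ψ) n) =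
        pathConj p (C.map ψ) n (ψ b)) :
    IsPGroup p Ψ.range := by
  have letter : ∀ i, ∀ a ∈ S i, Raises 1 ((Ψ a : PathEnd p (C.map ψ) n) -
      pathAction p (C.map ψ) n (ψ a)) := by
    intro i a ha
    rcases zmod_two_eq_or 0 i with rfl | rfl
    · rw [h0 a ha, sub_self]
      exact fun k v _ L u _ => rfl
    · rw [h1 a ha]
      exact raises_pathConj_sub _
  have key : ∀ g, Raises 1 ((Ψ g : PathEnd p (C.map ψ) n) -
      pathAction p (C.map ψ) n (ψ g)) := by
    intro g
    obtain ⟨i, m, hg⟩ := hS.exists_word g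
    induction hg with
    | base i hc => exact letter 0 _ (hS.le 0 hc)
    | @cons i m a g ha _ _ ih =>
      have e : (Ψ (a * g) : PathEnd p (C.map ψ) n) -
          pathAction p (C.map ψ) n (ψ (a * g)) =
          (Ψ a - pathAction p (C.map ψ) n (ψ a)) * (Ψ g - pathAction p (C.map ψ) n (ψ g)) +
          ((Ψ a - pathAction p (C.map ψ) n (ψ a)) * pathAction p (C.map ψ) n (ψ g) +
          pathAction p (C.map ψ) n (ψ a) * (Ψ g - pathAction p (C.map ψ) n (ψ g))) := by
        simp only [map_mul, Units.val_mul, mul_sub, sub_mul]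
        abel
      rw [e]
      have hl := letter i a ha
      exact ((hl.mul ih).mono (by simp)).add ((hl.mul (raises_pathAction _)).add
        (((raises_pathAction _).mul ih).mono (by simp)))
  rw [isPGroup_iff_pow_pow_eq_one] at hP ⊢
  rintro ⟨_, g, rfl⟩
  obtain ⟨a, ha⟩ := hP (ψ g)
  have hr := key (g ^ p ^ a)
  rw [map_pow ψ, ha, map_one] at hr
  obtain ⟨b, hb⟩ := exists_one_add_pow_eq_one hp hr
  refine ⟨a + b, ?_⟩
  ext1
  ext1
  rw [add_sub_cancel, ← Units.val_pow_eq_pow_val, ← map_pow, ← pow_mul, ← pow_add, map_pow] at hb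
  exact hb

/-- The vector obtained from the trivial path by a word all of whose letters are mapped outside
the image of the amalgamated subgroup. -/
theorem exists_hasLeading {p : ℕ} [Fact p.Prime] (hS : IsAmalgam S C) {P : Type u} [Group P]
    (ψ : G →* P) {n : ℕ}
    (Ψ : G →* (PathEnd p (C.map ψ) n)ˣ)
    (h0 : ∀ a ∈ S 0, (Ψ a : PathEnd p (C.map ψ) n) =
        pathAction p (C.map ψ) n (ψ a))
    (h1 : ∀ b ∈ S 1, (Ψ b : PathEnd p (C.map ψ) n) =
        pathConj p (C.map ψ) n (ψ b))
    {v : PathModule p (C.map ψ) n} (hv : HasLeading v [] 1 1)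
    {i : ZMod 2} {m : ℕ} {g : G} (hg : AltWord S ((C.map ψ).comap ψ) C i m g) :
    ∃ L : List (Quotient (QuotientGroup.rightRel (C.map ψ))), ∃ ε : ZMod p, ε ≠ 0 ∧
      HasLeading ((Ψ g : PathEnd p (C.map ψ) n) v) L (ψ g) ε ∧
      L.length ≤ 2 * m ∧ (i = 0 → L.head? ≠ some (rightCoset _ (ψ g))) ∧
      (i = 1 → m = 0 ∧ L = [] ∨ L.head? = some (rightCoset _ (ψ g))) ∧
      (2 ≤ m → L ≠ []) := by
  induction hg with
  | @base i h hh =>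
    refine ⟨[], 1, one_ne_zero, ?_, by simp, by simp, by simp, by simp⟩
    rw [h0 h (hS.le 0 hh)]
    simpa using hv.action (ψ h)
  | @cons i m a g ha haE hg ih =>
    obtain ⟨L, ε, hε, hlead, hlen, hi0, hi1, hm⟩ := ih
    rw [map_mul, map_mul, Units.val_mul, Module.End.mul_apply]
    -- A letter from `S 0` keeps the list but moves the endpoint off the head coset, allowing the
    -- next extension; a letter from `S 1` adds two cosets. Hence the alternating head conditions
    -- and the bound `2 * m`.
    rcases zmod_two_eq_or 0 i with rfl | rfl
    · rw [h0 a ha]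
      have hi1 := hi1 (by simp)
      refine ⟨L, ε, hε, hlead.action _, by omega, fun _ => ?_, by simp, fun h2 => ?_⟩
      · rcases hi1 with ⟨-, rfl⟩ | h
        · simp
        · rw [h]
          simp only [ne_eq, Option.some.injEq, rightCoset_eq_iff]
          simpa using haE
      · rcases hi1 with ⟨rfl, rfl⟩ | h
        · omega
        · rintro rfl; simp at h
    · rw [h1 a ha]
      refine ⟨_, -ε, neg_ne_zero.2 hε, hlead.conj (hi0 (by decide)) haE, ?_, by simp, by simp,
        by simp⟩
      simp only [List.length_cons]
      omega

/-- Finitely many letters outside the closure of the amalgamated subgroup can be kept outside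
the image of this subgroup. -/
theorem exists_hom_altWord {p : ℕ} {i : ZMod 2} {n : ℕ} {g : G}
    (hcl : ∀ i, ∀ a ∈ S i, a ∈ pClosure p C → a ∈ C) (hg : AltWord S C C i n g) :
    ∃ (P : Type u) (_ : Group P) (_ : Finite P) (ψ : G →* P), IsPGroup p P ∧
      AltWord S ((C.map ψ).comap ψ) C i n g := by
  induction hg with
  | @base i h hh =>
    exact ⟨PUnit, inferInstance, inferInstance, 1, IsPGroup.of_subsingleton _ _, .base i hh⟩
  | @cons i n a g ha haC hg ih =>
    obtain ⟨P, _, _, ψ, hP, hψ⟩ := ih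
    have h1 : a ∉ pClosure p C := fun h => haC (hcl i a ha h)
    simp only [mem_pClosure, not_forall] at h1
    obtain ⟨Q, _, _, hQ, θ, hθ⟩ := h1
    refine ⟨P × Q, inferInstance, inferInstance, ψ.prod θ, isPGroup_prod hP hQ, .cons ha ?_ ?_⟩
    · rintro ⟨x, hx, e⟩
      exact hθ ⟨x, hx, congrArg Prod.snd e⟩
    · refine hψ.mono ?_
      rintro y ⟨x, hx, e⟩
      exact ⟨x, hx, congrArg Prod.fst e⟩

/-- If the amalgamated subgroup is closed in both factors, it is closed in the amalgam. -/
theorem IsAmalgam.pClosure_le {p : ℕ} (hp : p.Prime) (hS : IsAmalgam S C)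
    (hcl : ∀ i, ∀ a ∈ S i, a ∈ pClosure p C → a ∈ C) : pClosure p C ≤ C := by
  have := Fact.mk hp
  intro g hg
  obtain ⟨i, m, hw⟩ := hS.exists_word g
  rcases lt_or_ge m 2 with hm | hm
  · interval_cases m
    · exact hw.mem_of_zero
    · exact hcl i g (hS.mem_factor_of_one hw) hg
  exfalso
  obtain ⟨P, _, _, ψ, hP, hψ⟩ := exists_hom_altWord hcl hw
  -- Length `2 * m` is enough for the leading path of `g` not to be truncated.
  obtain ⟨Ψ, h0, h1⟩ := hS.exists_path_hom ψ p (2 * m)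
  have hPG := isPGroup_path_range hp hS hP ψ Ψ h0 h1
  have : Finite (PathEnd p (C.map ψ) (2 * m)) := finite_end
  classical
  obtain ⟨v, hv⟩ : ∃ v : PathModule p (C.map ψ) (2 * m), HasLeading v [] 1 1 := by
    refine ⟨Pi.single (⟨[], by simp⟩, 1) 1, fun h u => ?_, fun L' h u hlt => ?_⟩
    · simp [Pi.single_apply]
    · rw [Pi.single_eq_of_ne]
      intro e
      have : L' = [] := congrArg (fun t => t.1.1) e
      simp [this] at hlt
  obtain ⟨L, ε, hε, hlead, hlen, -, -, hne⟩ := exists_hasLeading hS ψ Ψ h0 h1 hv hψ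
  obtain ⟨c, hc, e⟩ := hg Ψ.range hPG Ψ.rangeRestrict
  have e : Ψ c = Ψ g := congrArg Subtype.val e
  -- An element of `C` only translates and so creates no nonempty path, whereas `Ψ g v` is nonzero
  -- at a nonempty one.
  have h2 := hlead.1 hlen (ψ g)
  rw [if_pos rfl, ← e, h0 c (hS.le 0 hc), pathAction_apply, hv.2] at h2
  · exact hε h2.symm
  · exact List.length_pos_iff.2 (hne hm)

end SeparableBase

/-! ### Closures of cyclic subgroups of the amalgam. -/

section Separability

variable {G : Type u} [Group G] {S : ZMod 2 → Subgroup G} {C : Subgroup G}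

theorem IsAmalgam.exists_lift_pair (hS : IsAmalgam S C) {U : Type u} [Group U] (i : ZMod 2)
    (α : S i →* U) (β : S (i + 1) →* U)
    (h : ∀ (c : G) (h0 : c ∈ S i) (h1 : c ∈ S (i + 1)), c ∈ C → α ⟨c, h0⟩ = β ⟨c, h1⟩) :
    ∃ Ψ : G →* U, ∀ s : S i, Ψ s = α s := by
  have key : ∀ j, ∃ γ : S j →* U, (∀ (e : j = i) (x : G) (hx : x ∈ S j), γ ⟨x, hx⟩ = α ⟨x, e ▸ hx⟩) ∧
      ∀ (e : j = i + 1) (x : G) (hx : x ∈ S j), γ ⟨x, hx⟩ = β ⟨x, e ▸ hx⟩ := by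
    intro j
    rcases zmod_two_eq_or i j with rfl | rfl
    · exact ⟨α, fun _ _ _ => rfl, fun e => by simp at e⟩
    · exact ⟨β, fun e => by simp at e, fun _ _ _ => rfl⟩
  choose γ hγ using key
  obtain ⟨Ψ, hΨ⟩ := hS.exists_lift γ (by
    intro c h0 h1 hc
    rcases zmod_two_eq_or 0 i with rfl | rfl
    · rw [(hγ 0).1 rfl, (hγ 1).2 (by decide)]
      exact h c _ _ hc
    · rw [(hγ 0).2 (by decide), (hγ 1).1 (by decide)]
      exact (h c _ _ hc).symm)
  refine ⟨Ψ, fun s => ?_⟩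
  rw [hΨ i s]
  exact (hγ i).1 rfl s s.2

variable {p : ℕ} (hp : p.Prime) (hG : ResiduallyPFinite p G) {c : G} (hc : ¬ IsOfFinOrder c)
  (hS : IsAmalgam S (Subgroup.zpowers c)) {i : ZMod 2}
include hp hG hc hS

/-- Every homomorphism of a factor to a finite `p`-group is dominated by one of the amalgam. -/
theorem exists_extension {P : Type u} [Group P] [Finite P] (hP : IsPGroup p P) (α : S i →* P) :
    ∃ (U : Type u) (_ : Group U) (_ : Finite U) (Ψ : G →* U), IsPGroup p U ∧
      ∀ s : S i, Ψ s = 1 → α s = 1 := by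
  have := Fact.mk hp
  have hcS : ∀ j, c ∈ S j := fun j => hS.le j (Subgroup.mem_zpowers c)
  obtain ⟨k, hk⟩ := IsPGroup.iff_orderOf.1 hP (α ⟨c, hcS i⟩)
  obtain ⟨Q, _, _, ψ, hQ, hψ⟩ := exists_hom_pow_dvd_orderOf hp hG hc k
  obtain ⟨m, hm⟩ := IsPGroup.iff_orderOf.1 hQ (ψ c)
  rw [hm, Nat.pow_dvd_pow_iff_le_right hp.one_lt] at hψ
  -- The image of `c` is cut down to order exactly `p ^ k`, matching `α c`, so that Higman's theorem
  -- supplies compatible maps on both factors.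
  obtain ⟨Q', _, _, π, hQ', hπ⟩ := exists_hom_orderOf_eq hp hQ (ψ c) hm hψ
  obtain ⟨U, iU, iF, κ₁, κ₂, hU, h₁, -, hκ⟩ :=
    exists_overgroup hp hP hQ' _ _ (hk.trans hπ.symm)
  obtain ⟨Ψ, hΨ⟩ := hS.exists_lift_pair i (κ₁.comp α)
    ((κ₂.comp (π.comp ψ)).comp (S (i + 1)).subtype) (by
      rintro _ h0 h1 ⟨j, rfl⟩
      have e : (⟨c ^ j, h0⟩ : S i) = ⟨c, hcS i⟩ ^ j := rfl
      change κ₁ (α ⟨c ^ j, h0⟩) = κ₂ (π (ψ (c ^ j)))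
      rw [e]
      simp only [map_zpow, hκ])
  refine ⟨U, iU, iF, Ψ, hU, fun s hs => ?_⟩
  rw [hΨ, MonoidHom.comp_apply] at hs
  exact (injective_iff_map_eq_one κ₁).1 h₁ _ hs

/-- The pro-`p` topology of the amalgam induces that of the factors. -/
theorem mem_of_mem_pClosure_of_isPSeparable {F : Subgroup G} (hF : F ≤ S i)
    (hsep : IsPSeparable p (F.subgroupOf (S i))) {g : G} (hg : g ∈ pClosure p F) (hgS : g ∈ S i) :
    g ∈ F := by
  rw [isPSeparable_iff] at hsep
  refine @hsep ⟨g, hgS⟩ fun P _ _ hP α => ?_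
  obtain ⟨U, _, _, Ψ, hU, hΨ⟩ := exists_extension hp hG hc hS hP α
  obtain ⟨x, hx, e⟩ := hg U hU Ψ
  refine ⟨⟨x, hF hx⟩, hx, ?_⟩
  have h := hΨ (⟨x, hF hx⟩⁻¹ * ⟨g, hgS⟩) (by
    change Ψ (x⁻¹ * g) = 1
    rw [map_mul, map_inv, e, inv_mul_cancel])
  rw [map_mul, map_inv, inv_mul_eq_one] at h
  exact h

/-- The case of a cyclic subgroup of the amalgamated subgroup. -/
theorem pClosure_le_of_mem_base {s : G} (hs : s ∈ Subgroup.zpowers c)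
    (hs0 : ¬ IsOfFinOrder s) (hiso : IsPPrimeIsolated p (Subgroup.zpowers s))
    (hsep : ∀ i, IsPSeparable p ((Subgroup.zpowers s).subgroupOf (S i))) :
    pClosure p (Subgroup.zpowers s) ≤ Subgroup.zpowers s := by
  have hle : Subgroup.zpowers s ≤ Subgroup.zpowers c := Subgroup.zpowers_le.2 hs
  obtain ⟨m, rfl⟩ := hs
  change ¬ IsOfFinOrder (c ^ m) at hs0
  have hm0 : m ≠ 0 := by rintro rfl; simp at hs0
  obtain ⟨k, n, hn, hkn⟩ := Nat.exists_eq_pow_mul_and_not_dvd (Int.natAbs_ne_zero.2 hm0) p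
    hp.one_lt.ne'
  -- Isolation strips the part of `m` prime to `p`. A `p ^ k`-th power of a point of the closure of
  -- `C` therefore lies in the closure of `⟨c ^ m⟩`, where separability in the factor applies.
  have hck : c ^ p ^ k ∈ Subgroup.zpowers (c ^ m) := by
    refine hiso.mem_of_pow_mem hn ?_
    rw [← pow_mul, ← hkn]
    have h : (m.natAbs : ℤ) = m ∨ (m.natAbs : ℤ) = -m := by omega
    rw [← zpow_natCast]
    rcases h with h | h <;> rw [h]
    · exact Subgroup.mem_zpowers _
    · rw [zpow_neg]; exact inv_mem (Subgroup.mem_zpowers _)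
  have hCcl : pClosure p (Subgroup.zpowers c) ≤ Subgroup.zpowers c := by
    refine hS.pClosure_le hp fun i a ha hac => ?_
    have h1 : a ^ p ^ k ∈ pClosure p (Subgroup.zpowers (c ^ m)) :=
      pClosure_zpowers_le (le_pClosure p _ hck) (pow_mem_pClosure hac _)
    have h2 := mem_of_mem_pClosure_of_isPSeparable hp hG hc hS (hle.trans (hS.le i)) (hsep i) h1
      (pow_mem ha _)
    exact mem_zpowers_of_pow_prime_pow_mem hp hG hc hac (hle h2)
  intro g hg
  have hgc : g ∈ Subgroup.zpowers c := hCcl (pClosure_le (hle.trans (le_pClosure p _)) hg)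
  exact mem_of_mem_pClosure_of_isPSeparable hp hG hc hS (hle.trans (hS.le 0)) (hsep 0) hg
    (hS.le 0 hgc)

/-- The case of a cyclic subgroup of a factor. -/
theorem pClosure_le_of_mem_factor {s : G} (hs : s ∈ S i)
    (hsC : ∀ a ∈ S i, a⁻¹ * s * a ∉ Subgroup.zpowers c)
    (hsep : IsPSeparable p ((Subgroup.zpowers s).subgroupOf (S i))) :
    pClosure p (Subgroup.zpowers s) ≤ Subgroup.zpowers s := by
  intro g hg
  have hcomm : Commute s g := commute_of_mem_pClosure hG hg (Commute.refl s)
  exact mem_of_mem_pClosure_of_isPSeparable hp hG hc hS (Subgroup.zpowers_le.2 hs) hsep hg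
    (hS.mem_factor_of_commute hs hsC hcomm)

/-- If the amalgamated subgroup is not closed in a factor, then its nontrivial elements are not
conjugated into it by elements of the other factor outside it. -/
theorem closed_of_conj_mem {b z : G} (hb : b ∈ S (i + 1)) (hbC : b ∉ Subgroup.zpowers c)
    (hz : z ∈ Subgroup.zpowers c) (hz1 : z ≠ 1) (hzb : b⁻¹ * z * b ∈ Subgroup.zpowers c)
    {a : G} (ha : a ∈ S i) (hac : a ∈ pClosure p (Subgroup.zpowers c)) :
    a ∈ Subgroup.zpowers c := by
  obtain ⟨m, rfl⟩ := hz
  change c ^ m ≠ 1 at hz1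
  have hm0 : m ≠ 0 := by rintro rfl; simp at hz1
  obtain ⟨k, n, hn, hkn⟩ := Nat.exists_eq_pow_mul_and_not_dvd (Int.natAbs_ne_zero.2 hm0) p
    hp.one_lt.ne'
  obtain ⟨l, hl, hml⟩ : ∃ l : ℤ, ¬ (p : ℤ) ∣ l ∧ m = (p ^ k : ℕ) * l := by
    rcases Int.natAbs_eq m with h | h
    · exact ⟨n, by exact_mod_cast hn, by rw [h, hkn]; push_cast; ring⟩
    · exact ⟨-n, by rw [dvd_neg]; exact_mod_cast hn, by rw [h, hkn]; push_cast; ring⟩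
  -- An exponent `l` prime to `p` is invertible in every finite `p`-group, so `c ^ m` and `c ^ p ^
  -- k` generate the same closed subgroup.
  have h1 : a ^ p ^ k ∈ pClosure p (Subgroup.zpowers (c ^ m)) := by
    refine pClosure_zpowers_le ?_ (pow_mem_pClosure hac (p ^ k))
    have := self_mem_pClosure_zpow hp (c ^ p ^ k) hl
    rwa [← zpow_natCast, ← zpow_mul, ← hml, zpow_natCast] at this
  have h2 : b⁻¹ * a ^ p ^ k * b ∈ pClosure p (Subgroup.zpowers c) :=
    pClosure_zpowers_le (le_pClosure p _ hzb) (conj_mem_pClosure h1 b)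
  have hcomm := commute_of_mem_pClosure_of_mem_pClosure hG h2 (pow_mem hac (p ^ k))
  refine mem_zpowers_of_pow_prime_pow_mem hp hG hc hac (k := k) ?_
  -- If `x ∉ C`, then `b⁻¹ * x * b` is reduced of length 3 and conjugating `x` by it gives length 7.
  -- Both elements lie in the abelian closure of `C`, so that conjugate is `x` itself, of length 1.
  by_contra hx
  set x := a ^ p ^ k with hxdef
  have hxS : x ∈ S i := pow_mem ha _
  have hw : AltWord S _ _ _ _ (b⁻¹ * x * b) := hS.conj_word (.of_letter hb hbC) hxS hx
  have hw' := hS.conj_word (hw.cast (by simp) rfl) hxS hx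
  have e : (b⁻¹ * x * b)⁻¹ * x * (b⁻¹ * x * b) = x := by
    rw [mul_assoc, hcomm.eq, inv_mul_cancel_left]
  rw [e] at hw'
  have := (hS.length_eq hw' (AltWord.of_letter hxS hx) (by simp)).1
  omega

/-- The case of a cyclically reduced generator. -/
theorem pClosure_le_of_cyclically_reduced {L : ℕ} {f : G}
    (hf : AltWord S (Subgroup.zpowers c) (Subgroup.zpowers c) i L f) (hL : (L : ZMod 2) = 0)
    (hL0 : 0 < L) (hiso : IsPPrimeIsolated p (Subgroup.zpowers f)) :
    pClosure p (Subgroup.zpowers f) ≤ Subgroup.zpowers f := by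
  have hpow : ∀ n, 0 < n → f ^ n ∉ Subgroup.zpowers c := fun n hn =>
    hS.notMem_of_pos (hf.pow hS.le hL n) (Nat.mul_pos hn hL0)
  have hf0 : ¬ IsOfFinOrder f := by
    rw [isOfFinOrder_iff_pow_eq_one]
    rintro ⟨n, hn, e⟩
    exact hpow n hn (e ▸ one_mem _)
  have hL2 : 2 ≤ L := by
    by_contra h
    obtain rfl : L = 1 := by omega
    simp at hL
  intro g hg
  have hgf : Commute g f := (commute_of_mem_pClosure hG hg (Commute.refl f)).symm
  obtain ⟨n, hn, m, hy⟩ := hS.exists_pow_mul_zpow_mem hf hL hL0 hgf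
  have hycl : g ^ n * f ^ m ∈ pClosure p (Subgroup.zpowers f) :=
    mul_mem (pow_mem hg n) (zpow_mem (le_pClosure p _ (Subgroup.mem_zpowers f)) m)
  refine hiso.mem_zpowers_of_pow_mem hp hG hf0 hg hn ?_
  by_contra hgn
  have hy1 : g ^ n * f ^ m ≠ 1 := fun h => hgn (by
    rw [mul_eq_one_iff_eq_inv, ← zpow_neg] at h
    exact ⟨-m, h.symm⟩)
  have hyf : Commute (g ^ n * f ^ m) f := (hgf.pow_left n).mul_left ((Commute.refl f).zpow_left m)
  have hCcl : pClosure p (Subgroup.zpowers c) ≤ Subgroup.zpowers c := by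
    refine hS.pClosure_le hp fun j a ha hac => ?_
    obtain ⟨b, hb, hbC, z, hz, hz1, hzb⟩ :=
      hS.exists_conj_mem_of_commute hf hL2 hy hy1 hyf (j + 1)
    exact closed_of_conj_mem hp hG hc hS hb hbC hz hz1 hzb ha hac
  -- A nontrivial `y ∈ C` in the closure of `⟨f⟩` would drag a positive power of `f` into the closed
  -- subgroup `C`.
  obtain ⟨v, hv⟩ := exists_pow_mem_pClosure hp hG hycl hy1
  exact hpow _ (pow_pos hp.pos v) (hCcl (pClosure_zpowers_le (le_pClosure p _ hy) hv))

omit hp hG hc hS in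
theorem mem_zpowers_conj_iff {x s g : G} :
    g ∈ Subgroup.zpowers (x * s * x⁻¹) ↔ x⁻¹ * g * x ∈ Subgroup.zpowers s := by
  constructor
  · rintro ⟨k, rfl⟩
    exact ⟨k, by simp only [conj_zpow]; group⟩
  · rintro ⟨k, hk⟩
    refine ⟨k, ?_⟩
    simp only [conj_zpow] at hk ⊢
    rw [hk]; group

omit hp hG hc hS in
theorem IsPPrimeIsolated.of_conj {x s : G}
    (h : IsPPrimeIsolated p (Subgroup.zpowers (x * s * x⁻¹))) :
    IsPPrimeIsolated p (Subgroup.zpowers s) := by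
  intro g q hq hqp hg
  have := h (x * g * x⁻¹) q hq hqp (by
    rw [mem_zpowers_conj_iff, conj_pow]
    convert hg using 1; group)
  rw [mem_zpowers_conj_iff] at this
  convert this using 1; group

omit hp hG hc hS in
theorem pClosure_conj_le {x s : G} (h : pClosure p (Subgroup.zpowers s) ≤ Subgroup.zpowers s) :
    pClosure p (Subgroup.zpowers (x * s * x⁻¹)) ≤ Subgroup.zpowers (x * s * x⁻¹) := by
  intro g hg
  rw [mem_zpowers_conj_iff]
  refine h ?_
  have := conj_mem_pClosure hg x
  convert this using 3; group

/-- A `p'`-isolated cyclic subgroup of the amalgam is closed if all its conjugates contained in a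
factor are separable there. -/
theorem pClosure_zpowers_le_self {f : G} (hiso : IsPPrimeIsolated p (Subgroup.zpowers f))
    (hsep : ∀ i x s, s ∈ S i → f = x * s * x⁻¹ →
      IsPSeparable p ((Subgroup.zpowers s).subgroupOf (S i))) :
    pClosure p (Subgroup.zpowers f) ≤ Subgroup.zpowers f := by
  by_cases hf : IsOfFinOrder f
  · rw [← isPSeparable_iff]
    exact isPSeparable_of_finite hG (Set.finite_coe_iff.1 (finite_zpowers.2 hf))
  rcases hS.exists_conj_cyclically_reduced f with ⟨i, x, s, hs, rfl⟩ | ⟨x, i, L, f', rfl, hw, hL, hL0⟩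
  · by_cases hsC : ∀ a ∈ S i, a⁻¹ * s * a ∉ Subgroup.zpowers c
    · exact pClosure_conj_le (pClosure_le_of_mem_factor hp hG hc hS hs hsC (hsep i x s hs rfl))
    push Not at hsC
    obtain ⟨a, -, ha⟩ := hsC
    have e : x * s * x⁻¹ = x * a * (a⁻¹ * s * a) * (x * a)⁻¹ := by group
    generalize a⁻¹ * s * a = s' at ha e
    rw [e] at hiso hf hsep ⊢
    refine pClosure_conj_le (pClosure_le_of_mem_base hp hG hc hS ha (fun h => hf ?_) hiso.of_conj
      fun j => hsep j _ s' (hS.le j ha) rfl)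
    obtain ⟨n, hn, h⟩ := isOfFinOrder_iff_pow_eq_one.1 h
    exact isOfFinOrder_iff_pow_eq_one.2 ⟨n, hn, by rw [conj_pow, h]; group⟩
  · exact pClosure_conj_le (pClosure_le_of_cyclically_reduced hp hG hc hS hw hL hL0 hiso.of_conj)

end Separability

/-! ### The pushout as an internal amalgam. -/

section Pushout

open Monoid

variable {A B : Type u} [Group A] [Group B] {H : Subgroup A} {K : Subgroup B} (φ : H ≃* K)

theorem embed_injective : ∀ i, Function.Injective (embed φ i)
  | false => H.subtype_injective
  | true => K.subtype_injective.comp φ.injective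

/-- The factors of an amalgam as subgroups, indexed by `ZMod 2`. -/
def factorRange (i : ZMod 2) : Subgroup (Amalgam φ) :=
  (PushoutI.of (φ := embed φ) (decide (i = 1))).range

theorem base_range_le (i : ZMod 2) : (PushoutI.base (embed φ)).range ≤ factorRange φ i := by
  rintro _ ⟨h, rfl⟩
  exact ⟨embed φ _ h, PushoutI.of_apply_eq_base _ _ _⟩

/-- This gives access to the normal form theorem for `PushoutI`. The clause on `fstIdx` is the
induction invariant that lets a letter of the other factor be prepended. -/
theorem exists_reduced_word {i : ZMod 2} {n : ℕ} {g : Amalgam φ}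
    (hg : AltWord (factorRange φ) (PushoutI.base (embed φ)).range (PushoutI.base (embed φ)).range
      i n g) :
    ∃ (w : CoprodI.Word (Factor A B)) (h : H), PushoutI.Reduced (embed φ) w ∧
      g = PushoutI.ofCoprodI w.prod * PushoutI.base (embed φ) h ∧ w.toList.length = n ∧
      w.fstIdx ≠ some (decide (i + 1 = 1)) := by
  induction hg with
  | @base i g hg =>
    obtain ⟨h, rfl⟩ := hg
    refine ⟨CoprodI.Word.empty, h, ?_, by simp, rfl, by simp [CoprodI.Word.fstIdx]⟩
    intro l hl
    simp [CoprodI.Word.empty] at hl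
  | @cons i n a g ha haE hg ih =>
    obtain ⟨w, h, hw, rfl, hn, hi⟩ := ih
    obtain ⟨a, rfl⟩ := ha
    rw [zmod_two_add_one_add_one] at hi
    have ha : a ∉ (embed φ (decide (i = 1))).range := by
      rintro ⟨x, rfl⟩
      exact haE ⟨x, (PushoutI.of_apply_eq_base _ _ _).symm⟩
    have ha1 : a ≠ 1 := fun h => ha (h ▸ one_mem _)
    refine ⟨CoprodI.Word.cons a w hi ha1, h, ?_, ?_, ?_, ?_⟩
    · intro l hl
      rcases List.mem_cons.1 hl with rfl | hl
      · exact ha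
      · exact hw l hl
    · rw [CoprodI.Word.prod_cons, map_mul, PushoutI.ofCoprodI_of, mul_assoc]
    · simp [CoprodI.Word.cons, hn]
    · simp only [CoprodI.Word.fstIdx, CoprodI.Word.cons, List.head?_cons, Option.map_some, ne_eq,
        Option.some.injEq]
      have : ∀ j : ZMod 2, ¬ decide (j = 1) = decide (j + 1 = 1) := by decide
      exact this i

theorem AltWord.exists_letter_mul {G : Type u} [Group G] {S : ZMod 2 → Subgroup G} {C : Subgroup G}
    (hC : ∀ i, C ≤ S i) {i j : ZMod 2} {n : ℕ} {s g : G} (hs : s ∈ S j)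
    (hg : AltWord S C C i n g) : ∃ i n, AltWord S C C i n (s * g) := by
  by_cases hsC : s ∈ C
  · exact ⟨i, n, hg.mul_mem_left hC hsC⟩
  rcases n with _ | n
  · exact ⟨j, 1, .cons hs hsC (.base _ hg.mem_of_zero)⟩
  rcases zmod_two_eq_or j i with rfl | rfl
  · obtain ⟨a, u, ha, haC, hu, rfl⟩ := hg.exists_cons
    rw [← mul_assoc]
    by_cases hsa : s * a ∈ C
    · exact ⟨_, _, hu.mul_mem_left hC hsa⟩
    · exact ⟨_, _, .cons ((S i).mul_mem hs ha) hsa hu⟩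
  · exact ⟨j, _, .cons hs hsC hg⟩

theorem isAmalgam_factorRange :
    IsAmalgam (factorRange φ) (PushoutI.base (embed φ)).range where
  le := base_range_le φ
  notMem {i n g} hg hgC := by
    obtain ⟨w, h, hw, rfl, hn, -⟩ := exists_reduced_word φ hg
    have h1 := (Subgroup.mul_mem_cancel_right _ (MonoidHom.mem_range.2 ⟨h, rfl⟩)).1 hgC
    have h2 := hw.eq_empty_of_mem_range (embed_injective φ) h1
    rw [h2] at hn
    simp [CoprodI.Word.empty] at hn
  exists_word g := by
    have hf : ∀ b (x : Factor A B b), PushoutI.of (φ := embed φ) b x ∈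
        factorRange φ (if b then 1 else 0) := by
      rintro (_ | _) x <;> exact ⟨x, rfl⟩
    have key : ∀ g g' : Amalgam φ, (∃ i n, AltWord (factorRange φ) (PushoutI.base (embed φ)).range
        (PushoutI.base (embed φ)).range i n g') →
        ∃ i n, AltWord (factorRange φ) (PushoutI.base (embed φ)).range
        (PushoutI.base (embed φ)).range i n (g * g') := by
      intro g
      induction g using PushoutI.induction_on with
      | of b x =>
        rintro g' ⟨i, n, hg'⟩
        exact hg'.exists_letter_mul (base_range_le φ) (hf b x)
      | base h =>
        rintro g' ⟨i, n, hg'⟩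
        exact ⟨i, n, hg'.mul_mem_left (base_range_le φ) ⟨h, rfl⟩⟩
      | mul x y hx hy =>
        intro g' hg'
        rw [mul_assoc]
        exact hx _ (hy _ hg')
    simpa using key g 1 ⟨0, 0, .base 0 (one_mem _)⟩
  exists_lift {U} _ α hα := by
    let f : ∀ b, Factor A B b →* U
      | false => (α 0).comp (PushoutI.of (φ := embed φ) false).rangeRestrict
      | true => (α 1).comp (PushoutI.of (φ := embed φ) true).rangeRestrict
    have hbase : ∀ i (h : H), PushoutI.base (embed φ) h ∈ factorRange φ i :=
      fun i h => base_range_le φ i ⟨h, rfl⟩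
    let k : H →* U := (f false).comp (embed φ false)
    have hk : ∀ b, (f b).comp (embed φ b) = k := by
      rintro (_ | _)
      · rfl
      · ext h
        have h0 : (⟨PushoutI.base (embed φ) h, hbase 0 h⟩ : factorRange φ 0) =
            ⟨PushoutI.of (φ := embed φ) false (embed φ false h), ⟨_, rfl⟩⟩ := by
          ext; exact (PushoutI.of_apply_eq_base _ _ _).symm
        have h1 : (⟨PushoutI.base (embed φ) h, hbase 1 h⟩ : factorRange φ 1) =
            ⟨PushoutI.of (φ := embed φ) true (embed φ true h), ⟨_, rfl⟩⟩ := by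
          ext; exact (PushoutI.of_apply_eq_base _ _ _).symm
        have := hα _ (hbase 0 h) (hbase 1 h) ⟨h, rfl⟩
        rw [h0, h1] at this
        exact this.symm
    refine ⟨PushoutI.lift f k hk, fun i s => ?_⟩
    rcases zmod_two_eq_or 0 i with rfl | rfl
    · obtain ⟨_, x, rfl⟩ := s
      exact PushoutI.lift_of f k hk x
    · obtain ⟨_, x, rfl⟩ := s
      exact PushoutI.lift_of f k hk x

theorem inA_injective : Function.Injective (inA φ) :=
  PushoutI.of_injective (embed_injective φ) false

theorem inB_injective : Function.Injective (inB φ) :=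
  PushoutI.of_injective (embed_injective φ) true

end Pushout

/-! ### Separability transferred along the embeddings of the factors. -/

section Transfer

variable {X G : Type u} [Group X] [Group G]

/-- A `p'`-isolated cyclic subgroup of `G` conjugate into an embedded group is separable there,
unless it is conjugate to a non-separable one. -/
theorem isPSeparable_subgroupOf_range {p : ℕ} {ι : X →* G} (hι : Function.Injective ι) {f x s : G}
    (hf : f = x * s * x⁻¹) (hs : s ∈ ι.range) (hiso : IsPPrimeIsolated p (Subgroup.zpowers f))
    (hD : ∀ D ∈ Delta p X, ¬ IsConjSubgroup (Subgroup.zpowers f) (D.map ι)) :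
    IsPSeparable p ((Subgroup.zpowers s).subgroupOf ι.range) := by
  subst hf
  obtain ⟨y, rfl⟩ := hs
  have hmap : (Subgroup.zpowers y).map ι = Subgroup.zpowers (ι y) := MonoidHom.map_zpowers ι y
  have hsep : IsPSeparable p (Subgroup.zpowers y) := by
    by_contra hns
    -- Isolation descends through conjugation and the injection, so a non-separable `⟨y⟩` would
    -- belong to the excluded family.
    refine hD (Subgroup.zpowers y) ⟨inferInstance, ?_, hns⟩ ⟨x, ?_⟩
    · intro g q hq hqp hg
      have h1 : ι g ^ q ∈ Subgroup.zpowers (ι y) := by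
        rw [← map_pow, ← hmap]; exact Subgroup.mem_map_of_mem ι hg
      have h2 := hiso.of_conj (ι g) q hq hqp h1
      rw [← hmap] at h2
      exact (Subgroup.mem_map_iff_mem hι).1 h2
    · rw [hmap, MonoidHom.map_zpowers]; rfl
  rw [isPSeparable_iff] at hsep ⊢
  rintro ⟨_, g, rfl⟩ hg
  have : g ∈ pClosure p (Subgroup.zpowers y) := by
    refine mem_pClosure_zpowers fun P _ _ hP ψ => ?_
    obtain ⟨⟨z, hz⟩, hz', e⟩ := hg P hP (ψ.comp (MonoidHom.ofInjective hι).symm.toMonoidHom)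
    obtain ⟨k, hk⟩ := hz'
    have e1 : (MonoidHom.ofInjective hι).symm ⟨ι g, ⟨g, rfl⟩⟩ = g :=
      (MonoidHom.ofInjective hι).symm_apply_apply g
    have e2 : (⟨z, hz⟩ : ι.range) = MonoidHom.ofInjective hι (y ^ k) := by
      ext
      simp only [map_zpow]
      exact hk.symm
    refine ⟨k, ?_⟩
    change ψ ((MonoidHom.ofInjective hι).symm ⟨z, hz⟩) =
      ψ ((MonoidHom.ofInjective hι).symm ⟨ι g, ⟨g, rfl⟩⟩) at e
    rw [e1, e2, MulEquiv.symm_apply_apply, map_zpow] at e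
    exact e
  have := Subgroup.mem_map_of_mem ι (hsep this)
  rw [hmap] at this
  exact this

end Transfer

end AmalgSep

theorem theorem2p3 {A B : Type u} [Group A] [Group B] (p : ℕ) (hp : p.Prime)
    (H : Subgroup A) (K : Subgroup B) (φ : H ≃* K)
    (hHcyc : IsCyclic H) (hHinf : Infinite H) (hKcyc : IsCyclic K) (hKinf : Infinite K)
    (hA : ∀ a ∈ Subgroup.centralizer (H : Set A), IsOfFinOrder a → a = 1)
    (hB : ∀ b ∈ Subgroup.centralizer (K : Set B), IsOfFinOrder b → b = 1)
    (hG : AmalgSep.ResiduallyPFinite p (AmalgSep.Amalgam φ)) :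
    AmalgSep.ConditionStarStar p φ := by
  obtain ⟨h, hh⟩ := hHcyc.exists_generator
  have hS := AmalgSep.isAmalgam_factorRange φ
  have hrange : (Monoid.PushoutI.base (AmalgSep.embed φ)).range =
      Subgroup.zpowers (Monoid.PushoutI.base (AmalgSep.embed φ) h) := by
    rw [MonoidHom.range_eq_map, ← (Subgroup.eq_top_iff' _).2 hh, MonoidHom.map_zpowers]
  rw [hrange] at hS
  -- The amalgamated subgroup embeds in the pushout, so its generator keeps infinite order.
  have hc : ¬ IsOfFinOrder (Monoid.PushoutI.base (AmalgSep.embed φ) h) := by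
    rw [(Monoid.PushoutI.base_injective (AmalgSep.embed_injective φ)).isOfFinOrder_iff,
      ← finite_zpowers]
    intro hfin
    rw [(Subgroup.eq_top_iff' _).2 hh] at hfin
    exact Set.infinite_univ hfin
  intro F hF hiso hDA hDB
  obtain ⟨f, rfl⟩ := (Subgroup.isCyclic_iff_exists_zpowers_eq_top F).1 hF
  rw [AmalgSep.isPSeparable_iff]
  refine AmalgSep.pClosure_zpowers_le_self hp hG hc hS hiso fun i x s hs e => ?_
  rcases AmalgSep.zmod_two_eq_or 0 i with rfl | rfl
  · exact AmalgSep.isPSeparable_subgroupOf_range (AmalgSep.inA_injective φ) e hs hiso hDA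
  · exact AmalgSep.isPSeparable_subgroupOf_range (AmalgSep.inB_injective φ) e hs hiso hDB
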